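/- For $n\in\mathbb N$ and $p\in[0,1]$ let $\Omega(n,p)$ be the probability space of random bipartite posets $P$ with ground set $A\sqcup A'$, $|A|=|A'|=n$, in which the only possible strict comparabilities are $a<a'$ with $(a,a')\in A\times A'$, and each of these $n^2$ comparabilities is present with probability $p$, independently of the others. Let $\dim(P)$ denote the (Dushnik--Miller) dimension of $P$: the least positive integer $d$ for which there are linear orders $L_1,\dots,L_d$ on the ground set with $x\le y$ in $P$ if and only if $x\le y$ in every $L_j$. Let $\phi(q)=\prod_{i=1}^{\infty}(1-q^i)$, and let $\log$ be the natural logarithm. \textbf{Theorem.} Let $0<\epsilon<1$ be fixed, let $q=q(n)\in[0,1]$ be such that $n^{-1}\log^2 n\le q\le 1/2$ for all sufficiently large $n$, and set $z=n^2q\log(1/\phi(q))$. Then for $P\in\Omega(n,1-q)$, with probability tending to $1$ as $n\to\infty$, $$ \dim(P)<\begin{cases} n-(2-\epsilon)\,\dfrac{\log(qn)}{q} & \text{if } n^{-1}\log^2 n\le q\le n^{-1/2}\log n,\\[2mm] n-\dfrac{qn}{2\log(qn)} & \text{if } n^{-1/2}\log n<q\le n^{-1/3},\\[2mm] n-\dfrac{n\log(1/\phi(q))}{\log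 z} & \text{if } \max\{n^{-1/3},\,n^{-1/2}\log n\}<q\le 1/2. \end{cases} $$ -/

import Mathlib

/-- A family `L` of linear orders is a *realizer* of the partial order `P` when `x ≤ y` in `P` if and
only if `x ≤ y` in every member of the family. In particular, every member is a linear extension
of `P`. -/
def IsRealizer {α ι : Type*} (P : PartialOrder α) (L : ι → LinearOrder α) : Prop :=
  ∀ x y : α, P.le x y ↔ ∀ j : ι, (L j).le x y

/-- The (Dushnik–Miller) *dimension* of a partial order: the least positive integer `d` for which there
is a realizer `L_1, …, L_d`. -/
noncomputable def posetDim {α : Type*} (P : PartialOrder α) : ℕ :=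
  sInf {d : ℕ | 0 < d ∧ ∃ L : Fin d → LinearOrder α, IsRealizer P L}

/-- If `¬ x ≤ y`, some linear extension puts `y` strictly below `x`. -/
theorem exists_linearExtension_reversing {α : Type*} (P : PartialOrder α) (x y : α)
    (hxy : ¬ P.le x y) :
    ∃ L : LinearOrder α, (∀ a b, P.le a b → L.le a b) ∧ ¬ L.le x y := by
  classical
  let r : α → α → Prop := fun a b => P.le a b ∨ (P.le a y ∧ P.le x b)
  have : IsPartialOrder α r :=
    { refl := fun a => Or.inl (P.le_refl a)
      trans := by
        rintro a b c (h | ⟨h1, h2⟩) (h' | ⟨h1', h2'⟩)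
        · exact Or.inl (P.le_trans _ _ _ h h')
        · exact Or.inr ⟨P.le_trans _ _ _ h h1', h2'⟩
        · exact Or.inr ⟨h1, P.le_trans _ _ _ h2 h'⟩
        · exact Or.inr ⟨h1, h2'⟩
      antisymm := by
        rintro a b (h | ⟨h1, h2⟩) (h' | ⟨h1', h2'⟩)
        · exact P.le_antisymm _ _ h h'
        · exact absurd (P.le_trans _ _ _ h2' (P.le_trans _ _ _ h h1')) hxy
        · exact absurd (P.le_trans _ _ _ h2 (P.le_trans _ _ _ h' h1)) hxy
        · exact absurd (P.le_trans _ _ _ h2 h1') hxy }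
  obtain ⟨s, hs, hrs⟩ := extend_partialOrder r
  let L : LinearOrder α :=
    { le := s
      lt := fun a b => s a b ∧ ¬ s b a
      lt_iff_le_not_ge := fun a b => Iff.rfl
      le_refl := hs.1.1.1.1
      le_trans := fun a b c => hs.1.1.2.1 a b c
      le_antisymm := fun a b => hs.1.2.1 a b
      le_total := fun a b => hs.2.1 a b
      toDecidableLE := Classical.decRel s }
  refine ⟨L, fun a b h => hrs a b (Or.inl h), fun h => hxy ?_⟩
  have h1 : s y x := hrs y x (Or.inr ⟨P.le_refl y, P.le_refl x⟩)
  have h2 : x = y := hs.1.2.1 x y h h1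
  exact h2 ▸ P.le_refl x

/-- A finite poset has a realizer, so its dimension is attained (and is not a default value). -/
theorem posetDim_spec {α : Type*} [Finite α] (P : PartialOrder α) :
    0 < posetDim P ∧ ∃ L : Fin (posetDim P) → LinearOrder α, IsRealizer P L := by
  classical
  have hex : ∃ L₀ : LinearOrder α, ∀ a b, P.le a b → L₀.le a b := by
    obtain ⟨s, hs, hrs⟩ := @extend_partialOrder α P.le
      { refl := P.le_refl, trans := P.le_trans, antisymm := P.le_antisymm }
    exact ⟨{ le := s
             lt := fun a b => s a b ∧ ¬ s b a
             lt_iff_le_not_ge := fun a b => Iff.rfl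
             le_refl := hs.1.1.1.1
             le_trans := fun a b c => hs.1.1.2.1 a b c
             le_antisymm := fun a b => hs.1.2.1 a b
             le_total := fun a b => hs.2.1 a b
             toDecidableLE := Classical.decRel s }, hrs⟩
  obtain ⟨L₀, hL₀⟩ := hex
  have key : ∀ z : Option (α × α), ∃ L : LinearOrder α, (∀ a b, P.le a b → L.le a b) ∧
      ∀ p, z = some p → ¬ P.le p.1 p.2 → ¬ L.le p.1 p.2 := by
    rintro (_ | ⟨x, y⟩)
    · exact ⟨L₀, hL₀, by simp⟩
    · by_cases h : P.le x y
      · exact ⟨L₀, hL₀, fun p hp hn => by cases hp; exact absurd h hn⟩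
      · obtain ⟨L, h1, h2⟩ := exists_linearExtension_reversing P x y h
        exact ⟨L, h1, fun p hp _ => by cases hp; exact h2⟩
  choose F hF1 hF2 using key
  have := Fintype.ofFinite α
  let e := (Fintype.equivFin (Option (α × α))).symm
  have hne : {d : ℕ | 0 < d ∧ ∃ L : Fin d → LinearOrder α, IsRealizer P L}.Nonempty := by
    refine ⟨Fintype.card (Option (α × α)), Fintype.card_pos, fun j => F (e j), fun x y =>
      ⟨fun h j => hF1 _ _ _ h, fun h => ?_⟩⟩
    by_contra hn
    have h' : (F (e (e.symm (some (x, y))))).le x y := h (e.symm (some (x, y)))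
    have h'' : e (e.symm (some (x, y))) = some (x, y) := Equiv.apply_symm_apply _ _
    exact hF2 _ (x, y) h'' hn h'
  exact Nat.sInf_mem hne

/-- The bipartite poset on the disjoint union `A ⊔ A'` determined by a set `R ⊆ A × A'`: the only
strict comparabilities are `a < a'` for `(a, a') ∈ R`. -/
@[reducible]
def bipartitePoset {A A' : Type*} (R : Set (A × A')) : PartialOrder (A ⊕ A') where
  le x y := x = y ∨ ∃ a a', x = Sum.inl a ∧ y = Sum.inr a' ∧ (a, a') ∈ R
  le_refl x := Or.inl rfl
  le_trans := by
    rintro x y z (rfl | ⟨a, a', rfl, rfl, h⟩) (rfl | ⟨b, b', hb, hb', h'⟩)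
    · exact Or.inl rfl
    · exact Or.inr ⟨b, b', hb, hb', h'⟩
    · exact Or.inr ⟨a, a', rfl, rfl, h⟩
    · cases hb
  le_antisymm := by
    rintro x y (rfl | ⟨a, a', rfl, rfl, h⟩) (h1 | ⟨b, b', hb, hb', h'⟩)
    · rfl
    · rfl
    · exact h1.symm
    · cases hb

/-- The law of the random bipartite poset `Ω(n, p)`, recorded by its set of pairs `(a, a') ∈ A × A'`
with `a < a'`, where `A = A' = Fin n` are two disjoint copies of an `n`-element set: each pair is a
comparability with probability `p`, independently of all others. -/
noncomputable def randomBipartite (n : ℕ) (p : unitInterval) :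
    MeasureTheory.Measure (Set (Fin n × Fin n)) :=
  ProbabilityTheory.setBernoulli Set.univ p

/-- The Euler product function `φ(q) = ∏_{i ≥ 1} (1 - q ^ i)`. -/
noncomputable def eulerProduct (q : ℝ) : ℝ := ∏' i : ℕ, (1 - q ^ (i + 1))

/-- The product defining `φ(q)` converges for `|q| < 1`. -/
theorem multipliable_eulerProduct {q : ℝ} (hq : |q| < 1) :
    Multipliable fun i : ℕ => 1 - q ^ (i + 1) := by
  have h : Summable fun i : ℕ => ‖-q ^ (i + 1)‖ := by
    simp only [norm_neg, norm_pow, Real.norm_eq_abs]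
    exact (summable_nat_add_iff 1).2 (summable_geometric_of_lt_one (abs_nonneg q) hq)
  simpa [sub_eq_add_neg] using multipliable_one_add_of_summable h

/-- The three-piece upper bound, as a function of `ε`, `n` and `q` (in the range
`n⁻¹ log² n ≤ q ≤ 1/2`). All logarithms are natural. -/
noncomputable def dimUpperBound (ε : ℝ) (n : ℕ) (q : ℝ) : ℝ :=
  if q ≤ (n : ℝ) ^ (-(1 / 2) : ℝ) * Real.log n then
    n - (2 - ε) * Real.log (q * n) / q
  else if q ≤ (n : ℝ) ^ (-(1 / 3) : ℝ) then
    n - q * n / (2 * Real.log (q * n))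
  else
    n - n * Real.log (1 / eulerProduct q) /
      Real.log ((n : ℝ) ^ 2 * q * Real.log (1 / eulerProduct q))

/-! Let `G` be the bipartite graph of incomparable pairs `(a, a')`; it is a random graph of density
`q`, and `ω e = true` marks its edges. A linear extension reverses the edges of a chain graph
(nested neighbourhoods, hence described by thresholds), so a cover of `G` by `d` chain graphs
contained in it gives dimension at most `d + 2` (`posetDim_le_of_thresholds`). The union of the two
stars at the ends of an edge is a chain graph inside `G`, so a nearly perfect matching gives about
`n`. The theorem is about what can be saved below `n`, and there are two ways.

Sparse range: if `X × Y` contains no edge and `|X| = |Y| = k`, every edge meets the complement of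
`X` or of `Y`, so about `n - k` double stars suffice (`posetDim_add_le_of_hasEmptySquare`). An empty
square of side nearly `2 log(qn)/q` is found by the second moment method over transversals of a
partition into groups (`bernProb_hasEmptySquare`, `overlap_pow_le`). For very small `q` this gives
only a small positive probability, but one that exceeds the concentration error of the largest side,
and bounded differences (`bernProb_boost`) turn it into high probability at a small cost in the
side.

Denser ranges: reserve `s` edges `(x j, y j)` and give each a block `Q j` of about `n / s` edges of
a matching of the remaining vertices, each of which forms a 4-cycle with the reserved edge. The
double star of such an edge can be enlarged to a chain graph that also contains many edges at `x j`
and `y j` (`posetDim_le_of_matching`). Only the edges `(x j, y l)` need attention: one is missed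
only if about `2n / s` given pairs are all non-edges. So all are covered once `s² (1 - q)^(2n/s)` is
small, and the reserved vertices cost nothing (`posetDim_le_of_blocks`). The density is split into
three independent layers, for the stars, the matchings inside blocks and this covering
(`bernProb_posetDim_add_le`). Both denser bounds follow from the resulting criterion
`exists_forall_bernProb_posetDim_lt`; of the Euler product only the estimates `q ≤ log(1/φ(q)) ≤
-1.9 log(1 - q)` are needed. -/

/-- The weight of `ω` under independent Bernoulli(`q`) coordinates. -/
noncomputable def bernWeight {E : Type*} [Fintype E] (q : ℝ) (ω : E → Bool) : ℝ :=
  ∏ e, bif ω e then q else 1 - q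

open Classical in
/-- The probability of the event `Q` under independent Bernoulli(`q`) coordinates. -/
noncomputable def bernProb {E : Type*} [Fintype E] [DecidableEq E] (q : ℝ) (Q : (E → Bool) → Prop) : ℝ :=
  ∑ ω, if Q ω then bernWeight q ω else 0

theorem bernWeight_nonneg {E : Type*} [Fintype E] {q : ℝ} (h0 : 0 ≤ q) (h1 : q ≤ 1) (ω : E → Bool) :
    0 ≤ bernWeight q ω := by
  refine Finset.prod_nonneg fun e _ => ?_
  cases ω e <;> simp <;> linarith

/-! ### Finite Bernoulli fields: union bounds and exposure in stages -/

section BernProb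

variable {E : Type*} [Fintype E] [DecidableEq E] {q : ℝ}

theorem sum_prod_bool (f : E → Bool → ℝ) :
    ∑ ω : E → Bool, ∏ e, f e (ω e) = ∏ e, (f e true + f e false) := by
  classical
  rw [← Fintype.prod_sum]
  simp

theorem sum_bernWeight (q : ℝ) : ∑ ω : E → Bool, bernWeight q ω = 1 := by
  have := sum_prod_bool (E := E) fun _ b => bif b then q else 1 - q
  simpa [bernWeight] using this

theorem bernProb_nonneg (h0 : 0 ≤ q) (h1 : q ≤ 1) (Q : (E → Bool) → Prop) : 0 ≤ bernProb q Q := by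
  refine Finset.sum_nonneg fun ω _ => ?_
  split_ifs
  · exact bernWeight_nonneg h0 h1 ω
  · exact le_rfl

theorem bernProb_mono (h0 : 0 ≤ q) (h1 : q ≤ 1) {Q Q' : (E → Bool) → Prop}
    (h : ∀ ω, Q ω → Q' ω) : bernProb q Q ≤ bernProb q Q' := by
  refine Finset.sum_le_sum fun ω _ => ?_
  have := bernWeight_nonneg h0 h1 ω
  by_cases hQ : Q ω
  · simp [hQ, h ω hQ]
  · simp only [hQ, if_false]
    split_ifs <;> simp [this]

theorem bernProb_true (q : ℝ) : bernProb q (fun _ : E → Bool => True) = 1 := by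
  simp [bernProb, sum_bernWeight]

theorem bernProb_le_one (h0 : 0 ≤ q) (h1 : q ≤ 1) (Q : (E → Bool) → Prop) : bernProb q Q ≤ 1 :=
  (bernProb_mono h0 h1 fun _ _ => trivial).trans_eq (bernProb_true q)

theorem bernProb_add_not (q : ℝ) (Q : (E → Bool) → Prop) :
    bernProb q Q + bernProb q (fun ω => ¬ Q ω) = 1 := by
  rw [← sum_bernWeight (E := E) q, bernProb, bernProb, ← Finset.sum_add_distrib]
  refine Finset.sum_congr rfl fun ω _ => ?_
  by_cases h : Q ω <;> simp [h]

theorem bernProb_exists_le (h0 : 0 ≤ q) (h1 : q ≤ 1) {ι : Type*} (s : Finset ι)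
    (Q : ι → (E → Bool) → Prop) :
    bernProb q (fun ω => ∃ i ∈ s, Q i ω) ≤ ∑ i ∈ s, bernProb q (Q i) := by
  classical
  simp only [bernProb]
  rw [Finset.sum_comm]
  refine Finset.sum_le_sum fun ω _ => ?_
  have hw := bernWeight_nonneg h0 h1 ω
  have hnn : ∀ i ∈ s, 0 ≤ if Q i ω then bernWeight q ω else 0 := fun i _ => by
    split_ifs <;> simp [hw]
  by_cases h : ∃ i ∈ s, Q i ω
  · obtain ⟨i, hi, hQ⟩ := h
    have h' : ∃ i ∈ s, Q i ω := ⟨i, hi, hQ⟩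
    rw [if_pos h']
    calc bernWeight q ω = if Q i ω then bernWeight q ω else 0 := by simp [hQ]
      _ ≤ _ := Finset.single_le_sum hnn hi
  · rw [if_neg h]
    exact Finset.sum_nonneg hnn

theorem bernProb_or_le (h0 : 0 ≤ q) (h1 : q ≤ 1) (Q Q' : (E → Bool) → Prop) :
    bernProb q (fun ω => Q ω ∨ Q' ω) ≤ bernProb q Q + bernProb q Q' := by
  have := bernProb_exists_le (E := E) h0 h1 (Finset.univ : Finset Bool)
    (fun b => bif b then Q else Q')
  simpa [or_comm] using this

/-- No coordinate of `D` is selected. -/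
theorem bernProb_forall_false (q : ℝ) (D : Finset E) :
    bernProb q (fun ω => ∀ e ∈ D, ω e = false) = (1 - q) ^ D.card := by
  classical
  have := sum_prod_bool (E := E) fun e b => if e ∈ D then (bif b then 0 else 1 - q)
    else (bif b then q else 1 - q)
  have h2 : ∏ e, ((if e ∈ D then (bif true then 0 else 1 - q) else (bif true then q else 1 - q)) +
      (if e ∈ D then (bif false then 0 else 1 - q) else (bif false then q else 1 - q)))
      = (1 - q) ^ D.card := by
    -- Coordinates outside `D` contribute `q + (1 - q) = 1`, those in `D` contribute `0 + (1 - q)`.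
    rw [← Finset.prod_const, ← Finset.prod_filter_mul_prod_filter_not Finset.univ (· ∈ D)]
    have : ∏ x with x ∉ D, ((if x ∈ D then (bif true then 0 else 1 - q)
        else (bif true then q else 1 - q)) +
      (if x ∈ D then (bif false then 0 else 1 - q) else (bif false then q else 1 - q))) = 1 := by
      refine Finset.prod_eq_one fun x hx => ?_
      have hx' := (Finset.mem_filter.1 hx).2
      simp [hx']
    rw [this, mul_one]
    have h3 : Finset.univ.filter (· ∈ D) = D := by ext; simp
    rw [h3]
    refine Finset.prod_congr rfl fun x hx => ?_
    simp [hx]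
  rw [h2] at this
  rw [← this, bernProb]
  refine Finset.sum_congr rfl fun ω _ => ?_
  by_cases h : ∀ e ∈ D, ω e = false
  · rw [if_pos h]
    refine Finset.prod_congr rfl fun e _ => ?_
    by_cases he : e ∈ D
    · simp [he, h e he]
    · simp [he]
  · rw [if_neg h]
    push Not at h
    obtain ⟨e, he, hne⟩ := h
    symm
    refine Finset.prod_eq_zero (Finset.mem_univ e) ?_
    have : ω e = true := by simpa using hne
    simp [he, this]

/-- A Bernoulli field is the union of two independent sparser ones. -/
theorem bernProb_or_field (q₁ q₂ : ℝ) (Q : (E → Bool) → Prop) :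
    bernProb (1 - (1 - q₁) * (1 - q₂)) Q =
      ∑ ω₁ : E → Bool, bernWeight q₁ ω₁ * bernProb q₂ fun ω₂ => Q fun e => ω₁ e || ω₂ e := by
  classical
  have key : ∀ ω : E → Bool, bernWeight (1 - (1 - q₁) * (1 - q₂)) ω =
      ∑ ω₁ : E → Bool, ∑ ω₂ : E → Bool, if (fun e => ω₁ e || ω₂ e) = ω then
        bernWeight q₁ ω₁ * bernWeight q₂ ω₂ else 0 := by
    intro ω
    let F : E → Bool → Bool → ℝ := fun e b c => if (b || c) = ω e then
      (bif b then q₁ else 1 - q₁) * (bif c then q₂ else 1 - q₂) else 0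
    have h1 : ∀ ω₁ ω₂ : E → Bool, (if (fun e => ω₁ e || ω₂ e) = ω then
        bernWeight q₁ ω₁ * bernWeight q₂ ω₂ else 0) = ∏ e, F e (ω₁ e) (ω₂ e) := by
      intro ω₁ ω₂
      by_cases h : (fun e => ω₁ e || ω₂ e) = ω
      · rw [if_pos h, bernWeight, bernWeight, ← Finset.prod_mul_distrib]
        refine Finset.prod_congr rfl fun e _ => ?_
        simp only [F]
        rw [if_pos (congrFun h e)]
      · rw [if_neg h]
        obtain ⟨e, he⟩ := Function.ne_iff.1 h
        symm
        refine Finset.prod_eq_zero (Finset.mem_univ e) ?_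
        simp only [F]
        rw [if_neg he]
    simp_rw [h1]
    have h2 : ∀ ω₁ : E → Bool, ∑ ω₂ : E → Bool, ∏ e, F e (ω₁ e) (ω₂ e) =
        ∏ e, (F e (ω₁ e) true + F e (ω₁ e) false) := fun ω₁ =>
      sum_prod_bool fun e c => F e (ω₁ e) c
    simp_rw [h2]
    rw [sum_prod_bool fun e b => F e b true + F e b false, bernWeight]
    refine Finset.prod_congr rfl fun e _ => ?_
    simp only [F]
    cases ω e <;> simp
    ring
  simp only [bernProb]
  have : ∀ ω : E → Bool, (if Q ω then bernWeight (1 - (1 - q₁) * (1 - q₂)) ω else 0) =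
      ∑ ω₁ : E → Bool, ∑ ω₂ : E → Bool, if (fun e => ω₁ e || ω₂ e) = ω then
        (if Q ω then bernWeight q₁ ω₁ * bernWeight q₂ ω₂ else 0) else 0 := by
    intro ω
    by_cases h : Q ω
    · simp only [h, if_true, key]
    · simp [h]
  simp_rw [this]
  rw [Finset.sum_comm]
  refine Finset.sum_congr rfl fun ω₁ _ => ?_
  rw [Finset.sum_comm, Finset.mul_sum]
  refine Finset.sum_congr rfl fun ω₂ _ => ?_
  rw [Finset.sum_ite_eq]
  simp [mul_ite]

/-- Two-stage exposure: a good first stage followed by a conditionally likely second stage. -/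
theorem bernProb_or_field_ge {q₁ q₂ a b : ℝ} (h₁ : 0 ≤ q₁) (h₁' : q₁ ≤ 1)
    (h₂ : 0 ≤ q₂) (h₂' : q₂ ≤ 1) (hb : b ≤ 1) (hb0 : 0 ≤ b)
    (Q₁ : (E → Bool) → Prop) (Q : (E → Bool) → Prop)
    (hQ₁ : 1 - a ≤ bernProb q₁ Q₁)
    (hQ : ∀ ω₁, Q₁ ω₁ → 1 - b ≤ bernProb q₂ fun ω₂ => Q fun e => ω₁ e || ω₂ e) :
    1 - a - b ≤ bernProb (1 - (1 - q₁) * (1 - q₂)) Q := by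
  classical
  rw [bernProb_or_field]
  have : bernProb q₁ Q₁ * (1 - b) ≤
      ∑ ω₁ : E → Bool, bernWeight q₁ ω₁ * bernProb q₂ fun ω₂ => Q fun e => ω₁ e || ω₂ e := by
    rw [bernProb, Finset.sum_mul]
    refine Finset.sum_le_sum fun ω₁ _ => ?_
    have hw := bernWeight_nonneg h₁ h₁' ω₁
    by_cases h : Q₁ ω₁
    · rw [if_pos h]
      exact mul_le_mul_of_nonneg_left (hQ ω₁ h) hw
    · rw [if_neg h, zero_mul]
      exact mul_nonneg hw (bernProb_nonneg h₂ h₂' _)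
  have h1 : bernProb q₁ Q₁ ≤ 1 := bernProb_le_one h₁ h₁' _
  nlinarith [mul_le_mul_of_nonneg_right hQ₁ (sub_nonneg.2 hb), mul_nonneg hb0 (sub_nonneg.2 (hQ₁.trans h1))]

end BernProb

-- Passes to the complementary graph: comparabilities of probability `1 - q` become unselected
-- coordinates, and selected coordinates, of probability `q`, are the incomparable pairs. Everything
-- is finite, so the measure of an event is a sum of weights.
open MeasureTheory ProbabilityTheory in
theorem randomBipartite_eq_bernProb (n : ℕ) (q : unitInterval)
    (Q : Set (Fin n × Fin n) → Prop) :
    randomBipartite n (unitInterval.symm q) {R | Q R} =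
      ENNReal.ofReal (bernProb (q : ℝ) fun ω : Fin n × Fin n → Bool => Q {e | ω e = false}) := by
  classical
  have hprob : IsProbabilityMeasure (randomBipartite n (unitInterval.symm q)) := by
    unfold randomBipartite; infer_instance
  rw [← ENNReal.ofReal_toReal (measure_ne_top (randomBipartite n (unitInterval.symm q)) {R | Q R}),
    ← measureReal_def]
  congr 1
  let e : (Fin n × Fin n → Bool) ≃ Set (Fin n × Fin n) :=
    { toFun := fun ω => {e | ω e = false}
      invFun := fun R e => !decide (e ∈ R)
      left_inv := fun ω => by ext x; simp
      right_inv := fun R => by ext x; simp }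
  have h1 : {R | Q R} = ⋃ R ∈ Finset.univ.filter Q, {R} := by ext; simp
  rw [h1, measureReal_biUnion_finset (by
    intro a _ b _ hab; simpa using hab) (by simp), Finset.sum_filter, bernProb,
    ← Equiv.sum_comp e]
  refine Finset.sum_congr rfl fun ω _ => ?_
  change (if Q {e | ω e = false} then _ else 0) = if Q {e | ω e = false} then _ else 0
  congr 1
  rw [randomBipartite, setBernoulli_real_singleton _ (Set.subset_univ _) (Set.finite_univ),
    bernWeight]
  have h2 : ∀ x : Fin n × Fin n, (bif ω x then (q : ℝ) else 1 - q) =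
      (if ω x = false then (1 - q : ℝ) else 1) * (if ω x = true then (q : ℝ) else 1) := by
    intro x; cases ω x <;> simp
  simp_rw [h2]
  rw [Finset.prod_mul_distrib, Finset.prod_ite, Finset.prod_ite]
  simp only [Finset.prod_const]
  have h3 : (e ω).ncard = (Finset.univ.filter fun x => ω x = false).card := by
    rw [← Set.ncard_coe_finset]; congr 1; ext; simp [e]
  have h4 : (Set.univ \ e ω).ncard = (Finset.univ.filter fun x => ω x = true).card := by
    rw [← Set.ncard_coe_finset]; congr 1; ext; simp [e]
  rw [h3, h4]
  simp

/-! ### Dimension bounds from covers by chain graphs -/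

theorem posetDim_le_card {α κ : Type*} [Fintype κ] [Nonempty κ] {P : PartialOrder α}
    (L : κ → LinearOrder α) (h : IsRealizer P L) : posetDim P ≤ Fintype.card κ := by
  refine Nat.sInf_le ⟨Fintype.card_pos, fun j => L ((Fintype.equivFin κ).symm j), fun x y => ?_⟩
  rw [h x y]
  exact ⟨fun H j => H _, fun H j => by
    have hj : (Fintype.equivFin κ).symm (Fintype.equivFin κ j) = j := Equiv.symm_apply_apply _ j
    exact hj ▸ H (Fintype.equivFin κ j)⟩

/-- The linear order on `A ⊕ A'` with `a` above `a'` exactly when `β a' ≤ α a`, ties being broken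
by `e`. -/
@[reducible]
noncomputable def thresholdOrder {A A' : Type*} (α : A → ℕ) (β : A' → ℕ) (e : A ⊕ A' → ℤ)
    (he : Function.Injective e) : LinearOrder (A ⊕ A') :=
  LinearOrder.lift' (fun x => toLex (Sum.elim (fun a => 2 * α a + 1) (fun b => 2 * β b) x, e x))
    fun _ _ h => he (congrArg (fun z => (ofLex z).2) h)

theorem thresholdOrder_le {A A' : Type*} {α : A → ℕ} {β : A' → ℕ} {e : A ⊕ A' → ℤ}
    {he : Function.Injective e} {x y : A ⊕ A'} :
    (thresholdOrder α β e he).le x y ↔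
      Sum.elim (fun a => 2 * α a + 1) (fun b => 2 * β b) x <
        Sum.elim (fun a => 2 * α a + 1) (fun b => 2 * β b) y ∨
      Sum.elim (fun a => 2 * α a + 1) (fun b => 2 * β b) x =
        Sum.elim (fun a => 2 * α a + 1) (fun b => 2 * β b) y ∧ e x ≤ e y :=
  Prod.Lex.toLex_le_toLex

/-- A cover of the incomparable pairs by chain graphs bounds the dimension. -/
theorem posetDim_le_of_thresholds {A A' ι : Type*} [Fintype A] [Fintype A'] [Fintype ι]
    (R : Set (A × A')) (α : ι → A → ℕ) (β : ι → A' → ℕ)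
    (hsub : ∀ i a a', β i a' ≤ α i a → (a, a') ∉ R)
    (hcov : ∀ a a', (a, a') ∉ R → ∃ i, β i a' ≤ α i a) :
    posetDim (bipartitePoset R) ≤ Fintype.card ι + 2 := by
  classical
  let e : A ⊕ A' → ℤ := fun x => (Fintype.equivFin (A ⊕ A') x : ℕ)
  have he : Function.Injective e := fun x y h => by
    simpa [e, Fin.val_inj] using h
  have he' : Function.Injective fun x => - e x := fun x y h => he (by simpa using h)
  -- The two extra orders put all of `A` below all of `A'` and break ties in opposite ways. They
  -- account for every non-relation except those of the form `¬ a ≤ a'`, which the threshold orders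
  -- reverse.
  let L : ι ⊕ Bool → LinearOrder (A ⊕ A') := Sum.elim (fun i => thresholdOrder (α i) (β i) e he)
    (fun b => if b then thresholdOrder (fun _ => 0) (fun _ => 1) e he
      else thresholdOrder (fun _ => 0) (fun _ => 1) _ he')
  have hL : IsRealizer (bipartitePoset R) L := by
    intro x y
    constructor
    · rintro (rfl | ⟨a, a', rfl, rfl, h⟩) j
      · exact (L j).le_refl x
      · rcases j with i | b
        · have : ¬ β i a' ≤ α i a := fun hle => hsub i a a' hle h
          refine (thresholdOrder_le (he := he)).2 (Or.inl ?_)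
          simp only [Sum.elim_inl, Sum.elim_inr]
          omega
        · cases b
          · exact (thresholdOrder_le (he := he')).2 (Or.inl (by simp))
          · exact (thresholdOrder_le (he := he)).2 (Or.inl (by simp))
    · intro h
      have h1 := (thresholdOrder_le (he := he)).1 (h (Sum.inr true))
      have h2 := (thresholdOrder_le (he := he')).1 (h (Sum.inr false))
      rcases x with a | a' <;> rcases y with b | b'
      · simp only [Sum.elim_inl, lt_irrefl, true_and, false_or] at h1 h2
        exact Or.inl (he (by omega))
      · by_contra hn
        have hR : (a, b') ∉ R := fun hR => hn (Or.inr ⟨a, b', rfl, rfl, hR⟩)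
        obtain ⟨i, hi⟩ := hcov a b' hR
        have h3 := (thresholdOrder_le (he := he)).1 (h (Sum.inl i))
        simp only [Sum.elim_inl, Sum.elim_inr] at h3
        omega
      · simp at h1
      · simp only [Sum.elim_inr, lt_irrefl, true_and, false_or] at h1 h2
        exact Or.inl (he (by omega))
  have := posetDim_le_card L hL
  simpa using this

/-- Stars of matched edges, each enlarged by an auxiliary edge, and single stars, covering all
incomparable pairs. -/
theorem posetDim_le_of_matching {A A' : Type*} [Fintype A] [Fintype A'] [DecidableEq A]
    [DecidableEq A'] (R : Set (A × A')) (M : Finset (A × A')) (aug : A × A' → A × A')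
    (W : Finset A) (W' : Finset A')
    (hM : ∀ p ∈ M, p ∉ R)
    (haug : ∀ p ∈ M, aug p ∉ R ∧ ((aug p).1, p.2) ∉ R ∧ (p.1, (aug p).2) ∉ R)
    (hcov : ∀ a a', (a, a') ∉ R → a ∈ W ∨ a' ∈ W' ∨ (∃ p ∈ M, a = p.1 ∨ a' = p.2 ∨
      (a = (aug p).1 ∧ (p.1, a') ∉ R) ∨ (a' = (aug p).2 ∧ (a, p.2) ∉ R))) :
    posetDim (bipartitePoset R) ≤ M.card + W.card + W'.card + 2 := by
  classical
  -- For `p = (a, b)` and `aug p = (x, y)` the levels encode this nested family of neighbourhoods in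
  -- the incomparability graph: `N(a)` for `a`; `b`, `y` and `N(a) ∩ N(x)` for `x`; `{b, y}` for the
  -- common neighbours of `b` and `y`; `{b}` for the other neighbours of `b`; nothing for the rest.
  -- It contains both stars of `p`, the edges at `x` into `N(a)` and the edges at `y` into `N(b)`.
  let α : M ⊕ W ⊕ W' → A → ℕ := Sum.elim
    (fun p u => if u = p.1.1 then 4 else if u = (aug p.1).1 then 3 else
      if (u, p.1.2) ∉ R then (if (u, (aug p.1).2) ∉ R then 2 else 1) else 0)
    (Sum.elim (fun w u => if u = w.1 then 1 else 0) (fun w u => if (u, w.1) ∉ R then 1 else 0))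
  let β : M ⊕ W ⊕ W' → A' → ℕ := Sum.elim
    (fun p v => if v = p.1.2 then 1 else if v = (aug p.1).2 then 2 else
      if (p.1.1, v) ∉ R then (if ((aug p.1).1, v) ∉ R then 3 else 4) else 5)
    (Sum.elim (fun w v => if (w.1, v) ∉ R then 1 else 2) (fun w v => if v = w.1 then 1 else 2))
  have h := posetDim_le_of_thresholds R α β ?_ ?_
  · simpa [add_assoc] using h
  · rintro (p | w | w) a a' hle
    · obtain ⟨⟨p1, p2⟩, hp⟩ := p
      have h1 := hM _ hp
      obtain ⟨h2, h3, h4⟩ := haug _ hp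
      rcases hz : aug (p1, p2) with ⟨x, y⟩
      rw [hz] at h2 h3 h4
      simp only [α, β, Sum.elim_inl, hz] at hle h1 h2 h3 h4
      split_ifs at hle <;> first | omega | (subst_vars; assumption)
    · simp only [α, β, Sum.elim_inl, Sum.elim_inr] at hle
      split_ifs at hle <;> first | omega | (subst_vars; assumption)
    · simp only [α, β, Sum.elim_inr] at hle
      split_ifs at hle <;> first | omega | (subst_vars; assumption)
  · intro a a' hR
    rcases hcov a a' hR with hW | hW | ⟨p, hp, h⟩
    · refine ⟨Sum.inr (Sum.inl ⟨a, hW⟩), ?_⟩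
      simp [α, β, hR]
    · refine ⟨Sum.inr (Sum.inr ⟨a', hW⟩), ?_⟩
      simp [α, β, hR]
    · refine ⟨Sum.inl ⟨p, hp⟩, ?_⟩
      simp only [α, β, Sum.elim_inl]
      rcases h with rfl | rfl | ⟨rfl, h⟩ | ⟨rfl, h⟩
      · split_ifs <;> first | omega | contradiction
      · split_ifs <;> first | omega | contradiction
      · split_ifs <;> first | omega | contradiction
      · split_ifs <;> first | omega | contradiction

/-! ### Matchings and disjoint stars from Hall's theorem -/

/-- Hall's theorem with deficiency for bipartite relations without large empty rectangles. -/
theorem exists_matching_of_no_empty_rectangle {A B : Type*} [DecidableEq A] [DecidableEq B]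
    (R : A → B → Prop) (X₀ : Finset A) (Y₀ : Finset B) {N r : ℕ} (hX : X₀.card = N)
    (hY : Y₀.card = N) (hr : 0 < r)
    (h1 : ∀ X ⊆ X₀, ∀ Y ⊆ Y₀, r ≤ X.card → N ≤ 2 * Y.card → ∃ x ∈ X, ∃ y ∈ Y, R x y)
    (h2 : ∀ X ⊆ X₀, ∀ Y ⊆ Y₀, N ≤ 2 * X.card → r ≤ Y.card → ∃ x ∈ X, ∃ y ∈ Y, R x y) :
    ∃ M : Finset (A × B), (∀ p ∈ M, p.1 ∈ X₀ ∧ p.2 ∈ Y₀ ∧ R p.1 p.2) ∧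
      Set.InjOn Prod.fst (M : Set (A × B)) ∧ Set.InjOn Prod.snd (M : Set (A × B)) ∧
      N ≤ M.card + r := by
  classical
  -- Adjoining `r` dummy partners adjacent to everything turns deficiency `r` into Hall's condition.
  let T : X₀ → Finset (B ⊕ Fin r) := fun x =>
    (Y₀.filter (R x)).disjSum Finset.univ
  have hall : ∀ s : Finset X₀, s.card ≤ (s.biUnion T).card := by
    intro s
    rcases s.eq_empty_or_nonempty with rfl | ⟨x₀, hx₀⟩
    · simp
    let Z : Finset B := Y₀.filter fun y => ∃ x ∈ s, R x y
    have hsub : Z.disjSum (Finset.univ : Finset (Fin r)) ⊆ s.biUnion T := by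
      intro z hz
      rw [Finset.mem_biUnion]
      rcases z with y | i
      · have : y ∈ Z := by simpa using hz
        obtain ⟨hy, x, hx, hxy⟩ := Finset.mem_filter.1 this
        exact ⟨x, hx, by simp [T, hy, hxy]⟩
      · exact ⟨x₀, hx₀, by simp [T]⟩
    have hc := Finset.card_le_card hsub
    rw [Finset.card_disjSum, Finset.card_univ, Fintype.card_fin] at hc
    by_contra hlt
    push Not at hlt
    let X : Finset A := s.map (Function.Embedding.subtype _)
    have hXs : X ⊆ X₀ := by
      intro x hx
      obtain ⟨y, _, rfl⟩ := Finset.mem_map.1 hx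
      exact y.2
    have hXc : X.card = s.card := Finset.card_map _
    have hne : ∀ x ∈ X, ∀ y ∈ Y₀ \ Z, ¬ R x y := by
      intro x hx y hy hxy
      obtain ⟨x', hx', rfl⟩ := Finset.mem_map.1 hx
      obtain ⟨hy1, hy2⟩ := Finset.mem_sdiff.1 hy
      exact hy2 (Finset.mem_filter.2 ⟨hy1, x', hx', hxy⟩)
    have hZc : (Y₀ \ Z).card + Z.card = N := by
      rw [← hY]; exact Finset.card_sdiff_add_card_eq_card (Finset.filter_subset _ _)
    have hXN : X.card ≤ N := hX ▸ Finset.card_le_card hXs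
    -- A violator `X` has `|Z| + r < |X|`, so `X × (Y₀ \ Z)` is an empty rectangle. If `X` has at
    -- least half of the vertices, the other side still has more than `r`; if not, the other side
    -- has more than half and `X` more than `r`.
    by_cases hk : N ≤ 2 * X.card
    · obtain ⟨x, hx, y, hy, hxy⟩ := h2 X hXs (Y₀ \ Z) Finset.sdiff_subset hk (by omega)
      exact hne x hx y hy hxy
    · obtain ⟨x, hx, y, hy, hxy⟩ := h1 X hXs (Y₀ \ Z) Finset.sdiff_subset (by omega) (by omega)
      exact hne x hx y hy hxy
  obtain ⟨f, hf, hfT⟩ := (Finset.all_card_le_biUnion_card_iff_exists_injective T).1 hall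
  let M : Finset (A × B) := (X₀ ×ˢ Y₀).filter fun p => ∃ h : p.1 ∈ X₀, f ⟨p.1, h⟩ = Sum.inl p.2
  refine ⟨M, ?_, ?_, ?_, ?_⟩
  · rintro ⟨x, y⟩ hp
    obtain ⟨hp1, hx, hfx⟩ := Finset.mem_filter.1 hp
    have := hfT ⟨x, hx⟩
    rw [hfx] at this
    simp only [T, Finset.inl_mem_disjSum, Finset.mem_filter] at this
    exact ⟨hx, this⟩
  · rintro ⟨x, y⟩ hp ⟨x', y'⟩ hp' (rfl : x = x')
    obtain ⟨-, hx, hfx⟩ := Finset.mem_filter.1 hp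
    obtain ⟨-, hx', hfx'⟩ := Finset.mem_filter.1 hp'
    have : (Sum.inl y : B ⊕ Fin r) = Sum.inl y' := hfx.symm.trans hfx'
    simpa using this
  · rintro ⟨x, y⟩ hp ⟨x', y'⟩ hp' (rfl : y = y')
    obtain ⟨-, hx, hfx⟩ := Finset.mem_filter.1 hp
    obtain ⟨-, hx', hfx'⟩ := Finset.mem_filter.1 hp'
    have := hf (hfx.trans hfx'.symm)
    simpa using this
  · have hcov : (Finset.univ : Finset X₀).image f ⊆
        (M.image Prod.snd).disjSum (Finset.univ : Finset (Fin r)) := by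
      intro z hz
      obtain ⟨x, -, rfl⟩ := Finset.mem_image.1 hz
      have hT := hfT x
      rcases hfx : f x with y | i
      · rw [hfx] at hT
        simp only [T, Finset.inl_mem_disjSum, Finset.mem_filter] at hT
        rw [Finset.inl_mem_disjSum, Finset.mem_image]
        exact ⟨(x, y), Finset.mem_filter.2 ⟨Finset.mem_product.2 ⟨x.2, hT.1⟩, x.2, hfx⟩, rfl⟩
      · simp
    have := Finset.card_le_card hcov
    rw [Finset.card_image_of_injective _ hf, Finset.card_disjSum, Finset.card_univ,
      Finset.card_univ, Fintype.card_fin, Fintype.card_coe, hX] at this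
    exact this.trans (Nat.add_le_add_right Finset.card_image_le _)

/-- Disjoint stars with `t` leaves for all but few centres. -/
theorem exists_disjoint_stars {J B : Type*} [Fintype J] [DecidableEq J] [DecidableEq B]
    (R : J → B → Prop) (B₀ : Finset B) {t r k : ℕ}
    (hcard : t * Fintype.card J + k ≤ B₀.card)
    (h : ∀ (X : Finset J), ∀ Y ⊆ B₀, r ≤ X.card → k ≤ Y.card → ∃ x ∈ X, ∃ y ∈ Y, R x y) :
    ∃ (Bad : Finset J) (T : J → Finset B), Bad.card ≤ r ∧
      (∀ j ∉ Bad, T j ⊆ B₀ ∧ (T j).card = t ∧ ∀ b ∈ T j, R j b) ∧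
      (∀ i ∉ Bad, ∀ j ∉ Bad, i ≠ j → Disjoint (T i) (T j)) := by
  classical
  let N : Finset J → Finset B := fun X => B₀.filter fun b => ∃ x ∈ X, R x b
  -- `Bad` is a largest set of centres with at most `t` neighbours per centre. By maximality every
  -- set disjoint from it expands by a factor `t`, which is Hall's condition for `t` copies of each
  -- remaining centre. `Bad` is small because it and its non-neighbours form an empty rectangle.
  obtain ⟨Bad, hBadV, hmax⟩ := Finset.exists_max_image
    (Finset.univ.filter fun X : Finset J => (N X).card ≤ t * X.card) Finset.card
    ⟨∅, by simp [N]⟩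
  replace hBadV : (N Bad).card ≤ t * Bad.card := by simpa using hBadV
  have hBad : Bad.card ≤ r := by
    by_contra hlt
    push Not at hlt
    have hs : (B₀ \ N Bad).card + (N Bad).card = B₀.card :=
      Finset.card_sdiff_add_card_eq_card (Finset.filter_subset _ _)
    have h1 : t * Bad.card ≤ t * Fintype.card J := Nat.mul_le_mul_left _ (Finset.card_le_univ _)
    obtain ⟨x, hx, y, hy, hxy⟩ := h Bad (B₀ \ N Bad) Finset.sdiff_subset hlt.le (by omega)
    obtain ⟨hy1, hy2⟩ := Finset.mem_sdiff.1 hy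
    exact hy2 (Finset.mem_filter.2 ⟨hy1, x, hx, hxy⟩)
  have hexp : ∀ Z : Finset J, Disjoint Bad Z → t * Z.card ≤ (N Z).card := by
    intro Z hZ
    by_contra hlt
    push Not at hlt
    have hU : (N (Bad ∪ Z)).card ≤ (N Bad).card + (N Z).card := by
      refine (Finset.card_le_card ?_).trans (Finset.card_union_le _ _)
      intro b hb
      obtain ⟨hb0, x, hx, hxb⟩ := Finset.mem_filter.1 hb
      rcases Finset.mem_union.1 hx with hx | hx
      · exact Finset.mem_union_left _ (Finset.mem_filter.2 ⟨hb0, x, hx, hxb⟩)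
      · exact Finset.mem_union_right _ (Finset.mem_filter.2 ⟨hb0, x, hx, hxb⟩)
    have hc := Finset.card_union_of_disjoint hZ
    have := hmax (Bad ∪ Z) (by
      simp only [Finset.mem_filter, Finset.mem_univ, true_and]
      rw [hc, mul_add]; omega)
    have hZ0 : Z.card = 0 := by omega
    rw [hZ0] at hlt
    omega
  let S : {j // j ∉ Bad} × Fin t → Finset B := fun p => B₀.filter (R p.1)
  have hall : ∀ s : Finset ({j // j ∉ Bad} × Fin t), s.card ≤ (s.biUnion S).card := by
    intro s
    let Z : Finset J := (s.image Prod.fst).map (Function.Embedding.subtype _)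
    have hZ : Disjoint Bad Z := by
      rw [Finset.disjoint_right]
      intro z hz
      obtain ⟨y, _, rfl⟩ := Finset.mem_map.1 hz
      exact y.2
    have h1 : s.card ≤ t * Z.card := by
      have : s ⊆ (s.image Prod.fst) ×ˢ (Finset.univ : Finset (Fin t)) := by
        intro p hp
        exact Finset.mem_product.2 ⟨Finset.mem_image_of_mem _ hp, Finset.mem_univ _⟩
      have := Finset.card_le_card this
      rw [Finset.card_product, Finset.card_univ, Fintype.card_fin, mul_comm] at this
      simpa [Z] using this
    refine h1.trans ((hexp Z hZ).trans (Finset.card_le_card ?_))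
    intro b hb
    obtain ⟨hb0, x, hx, hxb⟩ := Finset.mem_filter.1 hb
    obtain ⟨y, hy, rfl⟩ := Finset.mem_map.1 hx
    obtain ⟨p, hp, rfl⟩ := Finset.mem_image.1 hy
    exact Finset.mem_biUnion.2 ⟨p, hp, Finset.mem_filter.2 ⟨hb0, hxb⟩⟩
  obtain ⟨f, hf, hfS⟩ := (Finset.all_card_le_biUnion_card_iff_exists_injective S).1 hall
  refine ⟨Bad, fun j => if hj : j ∈ Bad then ∅ else Finset.univ.image fun i => f (⟨j, hj⟩, i),
    hBad, ?_, ?_⟩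
  · intro j hj
    simp only [hj, dif_neg, not_false_eq_true]
    refine ⟨?_, ?_, ?_⟩
    · intro b hb
      obtain ⟨i, -, rfl⟩ := Finset.mem_image.1 hb
      exact (Finset.mem_filter.1 (hfS (⟨j, hj⟩, i))).1
    · rw [Finset.card_image_of_injective]
      · simp
      · intro i i' hii
        simpa using hf hii
    · intro b hb
      obtain ⟨i, -, rfl⟩ := Finset.mem_image.1 hb
      exact (Finset.mem_filter.1 (hfS (⟨j, hj⟩, i))).2
  · intro i hi j hj hij
    simp only [hi, hj, dif_neg, not_false_eq_true]
    rw [Finset.disjoint_left]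
    intro b hb hb'
    obtain ⟨u, -, rfl⟩ := Finset.mem_image.1 hb
    obtain ⟨v, -, hv⟩ := Finset.mem_image.1 hb'
    have := hf hv
    simp only [Prod.mk.injEq, Subtype.mk.injEq] at this
    exact hij this.1.symm

/-- Every rectangle with sides at least `r` and `m`, in either order, contains an edge of `G`. -/
def NoEmptyRectangle {A B : Type*} (G : A → B → Prop) (r m : ℕ) : Prop :=
  ∀ (X : Finset A) (Y : Finset B), (r ≤ X.card ∧ m ≤ Y.card ∨ m ≤ X.card ∧ r ≤ Y.card) →
    ∃ x ∈ X, ∃ y ∈ Y, G x y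

theorem NoEmptyRectangle.exists_matching {A B : Type*} [DecidableEq A] [DecidableEq B]
    {G : A → B → Prop} {r m : ℕ} (hG : NoEmptyRectangle G r m) (hr : 0 < r)
    (X₀ : Finset A) (Y₀ : Finset B) (hXY : X₀.card = Y₀.card) (hm : 2 * m ≤ X₀.card) :
    ∃ M : Finset (A × B), (∀ p ∈ M, p.1 ∈ X₀ ∧ p.2 ∈ Y₀ ∧ G p.1 p.2) ∧
      Set.InjOn Prod.fst (M : Set (A × B)) ∧ Set.InjOn Prod.snd (M : Set (A × B)) ∧
      X₀.card ≤ M.card + r :=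
  exists_matching_of_no_empty_rectangle G X₀ Y₀ rfl hXY.symm hr
    (fun X _ Y _ h1 h2 => hG X Y (Or.inl ⟨h1, by omega⟩))
    (fun X _ Y _ h1 h2 => hG X Y (Or.inr ⟨by omega, h2⟩))

theorem card_sdiff_image_of_injOn {α β : Type*} [DecidableEq β] {f : α → β} {M : Finset α}
    {X : Finset β} (hf : Set.InjOn f (M : Set α)) (h : ∀ p ∈ M, f p ∈ X) :
    (X \ M.image f).card + M.card = X.card := by
  rw [← Finset.card_image_of_injOn hf]
  exact Finset.card_sdiff_add_card_eq_card (Finset.image_subset_iff.2 h)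

/-! ### Reserved edges and their blocks -/

/-- The dimension bound obtained from reserved edges `x j, y j`, blocks `Q j` of matched pairs
assigned to them, and an almost perfect matching of the remaining elements. -/
theorem posetDim_le_of_blocks {n s r m t : ℕ} (R : Set (Fin n × Fin n))
    (hU : NoEmptyRectangle (fun a b => (a, b) ∉ R) r m) (hr : 0 < r)
    (x y : Fin s → Fin n) (hx : Function.Injective x) (hy : Function.Injective y)
    (hxy : ∀ j, (x j, y j) ∉ R) (J : Finset (Fin s)) (Q : Fin s → Finset (Fin n × Fin n))
    (hQ : ∀ j ∈ J, ∀ p ∈ Q j, p ∉ R ∧ (x j, p.2) ∉ R ∧ (p.1, y j) ∉ R ∧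
      p.1 ∉ Set.range x ∧ p.2 ∉ Set.range y)
    (hQ1 : ∀ j ∈ J, Set.InjOn Prod.fst (Q j : Set (Fin n × Fin n)))
    (hQ2 : ∀ j ∈ J, Set.InjOn Prod.snd (Q j : Set (Fin n × Fin n)))
    (hdisj : ∀ i ∈ J, ∀ j ∈ J, i ≠ j → ∀ p ∈ Q i, ∀ p' ∈ Q j, p.1 ≠ p'.1 ∧ p.2 ≠ p'.2)
    (hne : ∀ j ∈ J, (Q j).Nonempty) (ht : ∀ j ∈ J, (Q j).card ≤ t)
    (hcov : ∀ j ∈ J, ∀ l ∈ J, j ≠ l →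
      (∃ p ∈ Q j, (p.1, y l) ∉ R) ∨ ∃ p ∈ Q l, (x j, p.2) ∉ R)
    (hn : s + t * s + 2 * m ≤ n) (hJ : s ≤ J.card + 2 * r) :
    posetDim (bipartitePoset R) + s ≤ n + 3 * r + 2 := by
  classical
  let M₁ := J.biUnion Q
  have hM₁mem : ∀ p, p ∈ M₁ ↔ ∃ j ∈ J, p ∈ Q j := fun p => Finset.mem_biUnion
  have hM₁1 : Set.InjOn Prod.fst (M₁ : Set (Fin n × Fin n)) := by
    intro p hp p' hp' h
    obtain ⟨i, hi, hpi⟩ := (hM₁mem p).1 hp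
    obtain ⟨j, hj, hpj⟩ := (hM₁mem p').1 hp'
    by_cases hij : i = j
    · subst hij
      exact hQ1 i hi hpi hpj h
    · exact absurd h (hdisj i hi j hj hij p hpi p' hpj).1
  have hM₁2 : Set.InjOn Prod.snd (M₁ : Set (Fin n × Fin n)) := by
    intro p hp p' hp' h
    obtain ⟨i, hi, hpi⟩ := (hM₁mem p).1 hp
    obtain ⟨j, hj, hpj⟩ := (hM₁mem p').1 hp'
    by_cases hij : i = j
    · subst hij
      exact hQ2 i hi hpi hpj h
    · exact absurd h (hdisj i hi j hj hij p hpi p' hpj).2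
  have hM₁c : M₁.card ≤ t * s := by
    refine Finset.card_biUnion_le.trans ((Finset.sum_le_card_nsmul _ _ t ht).trans ?_)
    rw [smul_eq_mul, mul_comm]
    exact Nat.mul_le_mul_left _ ((Finset.card_le_univ J).trans_eq (Fintype.card_fin s))
  let X₁ := Finset.univ \ Finset.univ.image x
  let Y₁ := Finset.univ \ Finset.univ.image y
  have hX₁c : X₁.card + s = n := by
    have := card_sdiff_image_of_injOn (M := Finset.univ) (X := Finset.univ) (hx.injOn)
      (fun _ _ => Finset.mem_univ _)
    simpa using this
  have hY₁c : Y₁.card + s = n := by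
    have := card_sdiff_image_of_injOn (M := Finset.univ) (X := Finset.univ) (hy.injOn)
      (fun _ _ => Finset.mem_univ _)
    simpa using this
  let X₀ := X₁ \ M₁.image Prod.fst
  let Y₀ := Y₁ \ M₁.image Prod.snd
  have hX₀c : X₀.card + M₁.card = X₁.card := card_sdiff_image_of_injOn hM₁1 fun p hp => by
    obtain ⟨j, hj, hpj⟩ := (hM₁mem p).1 hp
    have := (hQ j hj p hpj).2.2.2.1
    simpa [X₁] using this
  have hY₀c : Y₀.card + M₁.card = Y₁.card := card_sdiff_image_of_injOn hM₁2 fun p hp => by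
    obtain ⟨j, hj, hpj⟩ := (hM₁mem p).1 hp
    have := (hQ j hj p hpj).2.2.2.2
    simpa [Y₁] using this
  obtain ⟨M₂, hM₂, hM₂1, hM₂2, hM₂c⟩ := hU.exists_matching hr X₀ Y₀ (by omega) (by omega)
  have hWc := card_sdiff_image_of_injOn hM₂1 fun p hp => (hM₂ p hp).1
  have hWc' := card_sdiff_image_of_injOn hM₂2 fun p hp => (hM₂ p hp).2.1
  -- Reserved edges with no block are put back into the matching; there are at most `2 * r` of them.
  let M₃ : Finset (Fin n × Fin n) := (Finset.univ \ J).image fun j => (x j, y j)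
  have hM₃c : M₃.card + J.card ≤ s := by
    have h1 : M₃.card ≤ (Finset.univ \ J).card := Finset.card_image_le
    have h2 : (Finset.univ \ J).card + J.card = (Finset.univ : Finset (Fin s)).card :=
      Finset.card_sdiff_add_card_eq_card (Finset.subset_univ J)
    rw [Finset.card_univ, Fintype.card_fin] at h2
    omega
  -- Outside the blocks `aug p = p`, for which the enlarged chain graph is just the double star of
  -- `p`. Disjointness of the blocks makes the chosen index the only possible one.
  let aug : Fin n × Fin n → Fin n × Fin n := fun p =>
    if h : ∃ j ∈ J, p ∈ Q j then (x h.choose, y h.choose) else p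
  have haug : ∀ j ∈ J, ∀ p ∈ Q j, aug p = (x j, y j) := by
    intro j hj p hp
    have h : ∃ j ∈ J, p ∈ Q j := ⟨j, hj, hp⟩
    have : h.choose = j := by
      by_contra hne
      exact (hdisj _ h.choose_spec.1 j hj hne p h.choose_spec.2 p hp).1 rfl
    simp only [aug]
    rw [dif_pos h, this]
  have hM : ∀ p ∈ M₁ ∪ M₂ ∪ M₃, p ∉ R := by
    intro p hp
    rcases Finset.mem_union.1 hp with hp | hp
    · rcases Finset.mem_union.1 hp with hp | hp
      · obtain ⟨j, hj, hpj⟩ := (hM₁mem p).1 hp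
        exact (hQ j hj p hpj).1
      · exact (hM₂ p hp).2.2
    · obtain ⟨j, _, rfl⟩ := Finset.mem_image.1 hp
      exact hxy j
  have hX : ∀ a, a ∈ X₀ \ M₂.image Prod.fst ∨ (∃ p ∈ M₁ ∪ M₂ ∪ M₃, a = p.1) ∨
      ∃ j ∈ J, a = x j := by
    intro a
    by_cases h1 : a ∈ M₂.image Prod.fst
    · obtain ⟨p, hp, rfl⟩ := Finset.mem_image.1 h1
      exact Or.inr (Or.inl ⟨p, by simp [hp], rfl⟩)
    by_cases h2 : a ∈ M₁.image Prod.fst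
    · obtain ⟨p, hp, rfl⟩ := Finset.mem_image.1 h2
      exact Or.inr (Or.inl ⟨p, by simp [hp], rfl⟩)
    by_cases h3 : a ∈ Finset.univ.image x
    · obtain ⟨j, -, rfl⟩ := Finset.mem_image.1 h3
      by_cases hj : j ∈ J
      · exact Or.inr (Or.inr ⟨j, hj, rfl⟩)
      · refine Or.inr (Or.inl ⟨(x j, y j), ?_, rfl⟩)
        exact Finset.mem_union_right _ (Finset.mem_image.2 ⟨j, by simp [hj], rfl⟩)
    · left
      simp only [X₀, X₁, Finset.mem_sdiff, Finset.mem_univ, true_and]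
      exact ⟨⟨h3, h2⟩, h1⟩
  have hY : ∀ a, a ∈ Y₀ \ M₂.image Prod.snd ∨ (∃ p ∈ M₁ ∪ M₂ ∪ M₃, a = p.2) ∨
      ∃ j ∈ J, a = y j := by
    intro a
    by_cases h1 : a ∈ M₂.image Prod.snd
    · obtain ⟨p, hp, rfl⟩ := Finset.mem_image.1 h1
      exact Or.inr (Or.inl ⟨p, by simp [hp], rfl⟩)
    by_cases h2 : a ∈ M₁.image Prod.snd
    · obtain ⟨p, hp, rfl⟩ := Finset.mem_image.1 h2
      exact Or.inr (Or.inl ⟨p, by simp [hp], rfl⟩)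
    by_cases h3 : a ∈ Finset.univ.image y
    · obtain ⟨j, -, rfl⟩ := Finset.mem_image.1 h3
      by_cases hj : j ∈ J
      · exact Or.inr (Or.inr ⟨j, hj, rfl⟩)
      · refine Or.inr (Or.inl ⟨(x j, y j), ?_, rfl⟩)
        exact Finset.mem_union_right _ (Finset.mem_image.2 ⟨j, by simp [hj], rfl⟩)
    · left
      simp only [Y₀, Y₁, Finset.mem_sdiff, Finset.mem_univ, true_and]
      exact ⟨⟨h3, h2⟩, h1⟩
  have key := posetDim_le_of_matching R (M₁ ∪ M₂ ∪ M₃) aug (X₀ \ M₂.image Prod.fst)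
    (Y₀ \ M₂.image Prod.snd) hM ?_ ?_
  -- The blocks and `X₀` together have `n - s` vertices. The loss `3 * r` is `r` for the second
  -- leftover set (the first completes `M₂` to `X₀`) and `2 * r` for `M₃`.
  · have hc1 := Finset.card_union_le (M₁ ∪ M₂) M₃
    have hc2 := Finset.card_union_le M₁ M₂
    omega
  · intro p hp
    by_cases h : ∃ j ∈ J, p ∈ Q j
    · obtain ⟨j, hj, hpj⟩ := h
      rw [haug j hj p hpj]
      obtain ⟨-, h2, h3, -⟩ := hQ j hj p hpj
      exact ⟨hxy j, h2, h3⟩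
    · have : aug p = p := dif_neg h
      rw [this]
      exact ⟨hM p hp, hM p hp, hM p hp⟩
  · intro a a' haa
    rcases hX a with h | ⟨p, hp, h⟩ | ⟨j, hj, rfl⟩
    · exact Or.inl h
    · exact Or.inr (Or.inr ⟨p, hp, Or.inl h⟩)
    rcases hY a' with h | ⟨p, hp, h⟩ | ⟨l, hl, rfl⟩
    · exact Or.inr (Or.inl h)
    · exact Or.inr (Or.inr ⟨p, hp, Or.inr (Or.inl h)⟩)
    have hmem : ∀ j ∈ J, ∀ p ∈ Q j, p ∈ M₁ ∪ M₂ ∪ M₃ := fun j hj p hp =>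
      Finset.mem_union_left _ (Finset.mem_union_left _ ((hM₁mem p).2 ⟨j, hj, hp⟩))
    refine Or.inr (Or.inr ?_)
    have hfirst : ∀ p ∈ Q j, (p.1, y l) ∉ R → ∃ p ∈ M₁ ∪ M₂ ∪ M₃, x j = p.1 ∨ y l = p.2 ∨
        (x j = (aug p).1 ∧ (p.1, y l) ∉ R) ∨ (y l = (aug p).2 ∧ (x j, p.2) ∉ R) := by
      intro p hp h
      refine ⟨p, hmem j hj p hp, Or.inr (Or.inr (Or.inl ⟨?_, h⟩))⟩
      rw [haug j hj p hp]
    -- What remains is an edge `(x j, y l)` between two reserved ends with blocks. For `j = l` any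
    -- member of the block covers it, through its edge to `y j`.
    by_cases hjl : j = l
    · subst hjl
      obtain ⟨p, hp⟩ := hne j hj
      exact hfirst p hp (hQ j hj p hp).2.2.1
    · rcases hcov j hj l hl hjl with ⟨p, hp, h⟩ | ⟨p, hp, h⟩
      · exact hfirst p hp h
      · refine ⟨p, hmem l hl p hp, Or.inr (Or.inr (Or.inr ⟨?_, h⟩))⟩
        rw [haug l hl p hp]

/-- Reserved edges together with stars of size `t` at almost all of their ends. -/
theorem NoEmptyRectangle.exists_stars {n s r m t : ℕ} {G : Fin n → Fin n → Prop}
    (hG : NoEmptyRectangle G r m) (hr : 0 < r) (hrs : r + s ≤ n) (hn : s + t * s + 2 * m ≤ n) :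
    ∃ (x y : Fin s → Fin n) (J : Finset (Fin s)) (T T' : Fin s → Finset (Fin n)),
      Function.Injective x ∧ Function.Injective y ∧ (∀ j, G (x j) (y j)) ∧ s ≤ J.card + 2 * r ∧
      (∀ j ∈ J, (T j).card = t ∧ ∀ a ∈ T j, a ∉ Set.range x ∧ G a (y j)) ∧
      (∀ j ∈ J, (T' j).card = t ∧ ∀ a ∈ T' j, a ∉ Set.range y ∧ G (x j) a) ∧
      (∀ i ∈ J, ∀ j ∈ J, i ≠ j → Disjoint (T i) (T j) ∧ Disjoint (T' i) (T' j)) := by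
  classical
  obtain ⟨M, hM, hM1, hM2, hMc⟩ := hG.exists_matching hr Finset.univ Finset.univ rfl
    (by rw [Finset.card_univ, Fintype.card_fin]; omega)
  rw [Finset.card_univ, Fintype.card_fin] at hMc
  obtain ⟨M', hM', hM'c⟩ := Finset.exists_subset_card_eq (show s ≤ M.card by omega)
  let e : Fin s ≃ M' := (Finset.equivFinOfCardEq hM'c).symm
  let x : Fin s → Fin n := fun j => (e j).1.1
  let y : Fin s → Fin n := fun j => (e j).1.2
  have hx : Function.Injective x := fun i j h =>
    e.injective (Subtype.ext (hM1 (hM' (e i).2) (hM' (e j).2) h))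
  have hy : Function.Injective y := fun i j h =>
    e.injective (Subtype.ext (hM2 (hM' (e i).2) (hM' (e j).2) h))
  have hX₁c : (Finset.univ \ Finset.univ.image x).card + s = n := by
    have := card_sdiff_image_of_injOn (M := Finset.univ) (X := Finset.univ) (hx.injOn)
      (fun _ _ => Finset.mem_univ _)
    simpa using this
  have hY₁c : (Finset.univ \ Finset.univ.image y).card + s = n := by
    have := card_sdiff_image_of_injOn (M := Finset.univ) (X := Finset.univ) (hy.injOn)
      (fun _ _ => Finset.mem_univ _)
    simpa using this
  obtain ⟨Bad, T, hBad, hT, hTd⟩ := exists_disjoint_stars (t := t) (r := r) (k := m)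
    (fun j a => G a (y j)) (Finset.univ \ Finset.univ.image x)
    (by rw [Fintype.card_fin]; omega) (by
      intro X Y _ hX hY
      obtain ⟨a, ha, b, hb, hab⟩ := hG Y (X.image y) (Or.inr ⟨hY, by
        rwa [Finset.card_image_of_injective _ hy]⟩)
      obtain ⟨j, hj, rfl⟩ := Finset.mem_image.1 hb
      exact ⟨j, hj, a, ha, hab⟩)
  obtain ⟨Bad', T', hBad', hT', hTd'⟩ := exists_disjoint_stars (t := t) (r := r) (k := m)
    (fun j a => G (x j) a) (Finset.univ \ Finset.univ.image y)
    (by rw [Fintype.card_fin]; omega) (by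
      intro X Y _ hX hY
      obtain ⟨a, ha, b, hb, hab⟩ := hG (X.image x) Y (Or.inl ⟨by
        rwa [Finset.card_image_of_injective _ hx], hY⟩)
      obtain ⟨j, hj, rfl⟩ := Finset.mem_image.1 ha
      exact ⟨j, hj, b, hb, hab⟩)
  refine ⟨x, y, Finset.univ \ (Bad ∪ Bad'), T, T', hx, hy, fun j => (hM _ (hM' (e j).2)).2.2,
    ?_, ?_, ?_, ?_⟩
  · have h1 := Finset.card_union_le Bad Bad'
    have h2 := Finset.card_sdiff_add_card_eq_card (Finset.subset_univ (Bad ∪ Bad'))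
    rw [Finset.card_univ, Fintype.card_fin] at h2
    omega
  · intro j hj
    simp only [Finset.mem_sdiff, Finset.mem_union, not_or] at hj
    obtain ⟨h1, h2, h3⟩ := hT j hj.2.1
    refine ⟨h2, fun a ha => ⟨?_, h3 a ha⟩⟩
    simpa using h1 ha
  · intro j hj
    simp only [Finset.mem_sdiff, Finset.mem_union, not_or] at hj
    obtain ⟨h1, h2, h3⟩ := hT' j hj.2.2
    refine ⟨h2, fun a ha => ⟨?_, h3 a ha⟩⟩
    simpa using h1 ha
  · intro i hi j hj hij
    simp only [Finset.mem_sdiff, Finset.mem_union, not_or] at hi hj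
    exact ⟨hTd i hi.2.1 j hj.2.1 hij, hTd' i hi.2.2 j hj.2.2 hij⟩

/-! ### Probability bounds for the block construction -/

section BernProb

variable {E : Type*} [Fintype E] [DecidableEq E] {q : ℝ}

theorem one_sub_le_bernProb {b : ℝ} {Q : (E → Bool) → Prop}
    (h : bernProb q (fun ω => ¬ Q ω) ≤ b) : 1 - b ≤ bernProb q Q := by
  linarith [bernProb_add_not q Q]

theorem bernProb_not_le {b : ℝ} {Q : (E → Bool) → Prop}
    (h : 1 - b ≤ bernProb q Q) : bernProb q (fun ω => ¬ Q ω) ≤ b := by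
  linarith [bernProb_add_not q Q]

/-- Union bound for `¬ Q` over a finite family of sets of unselected coordinates. -/
theorem bernProb_exists_forall_false_le (h0 : 0 ≤ q) (h1 : q ≤ 1) {ι : Type*} (s : Finset ι)
    (D : ι → Finset E) {k : ℕ} (hD : ∀ i ∈ s, k ≤ (D i).card) :
    bernProb q (fun ω => ∃ i ∈ s, ∀ e ∈ D i, ω e = false) ≤ s.card * (1 - q) ^ k := by
  refine (bernProb_exists_le h0 h1 s _).trans ?_
  rw [← nsmul_eq_mul]
  refine Finset.sum_le_card_nsmul _ _ _ fun i hi => ?_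
  rw [bernProb_forall_false]
  exact pow_le_pow_of_le_one (by linarith) (by linarith) (hD i hi)

end BernProb

/-- Union bound over all pairs of subsets; the crude count `2 ^ |X₀| * 2 ^ |Y₀|` is affordable
because both sides are later taken large enough for `(1 - q) ^ (a * b)` to beat it. -/
theorem bernProb_empty_rectangle_le {A B : Type*} [Fintype A] [Fintype B] [DecidableEq A]
    [DecidableEq B] {q : ℝ} (h0 : 0 ≤ q) (h1 : q ≤ 1) (X₀ : Finset A) (Y₀ : Finset B) (a b : ℕ) :
    bernProb q (fun ω : A × B → Bool => ∃ X ⊆ X₀, ∃ Y ⊆ Y₀, a ≤ X.card ∧ b ≤ Y.card ∧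
      ∀ x ∈ X, ∀ y ∈ Y, ω (x, y) = false) ≤ 2 ^ X₀.card * 2 ^ Y₀.card * (1 - q) ^ (a * b) := by
  classical
  let s := (X₀.powerset ×ˢ Y₀.powerset).filter fun p : Finset A × Finset B =>
    a ≤ p.1.card ∧ b ≤ p.2.card
  have h := bernProb_exists_forall_false_le h0 h1 s (fun p => p.1 ×ˢ p.2) (k := a * b) (by
    intro p hp
    rw [Finset.card_product]
    obtain ⟨-, h1, h2⟩ := Finset.mem_filter.1 hp
    exact Nat.mul_le_mul h1 h2)
  refine (bernProb_mono h0 h1 ?_).trans (h.trans ?_)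
  · rintro ω ⟨X, hX, Y, hY, ha, hb, hXY⟩
    refine ⟨(X, Y), ?_, ?_⟩
    · simp [s, hX, hY, ha, hb]
    · rintro ⟨x, y⟩ he
      obtain ⟨hx, hy⟩ := Finset.mem_product.1 he
      exact hXY x hx y hy
  · refine mul_le_mul_of_nonneg_right ?_ (pow_nonneg (by linarith) _)
    have : s.card ≤ 2 ^ X₀.card * 2 ^ Y₀.card := by
      refine (Finset.card_filter_le _ _).trans ?_
      rw [Finset.card_product, Finset.card_powerset, Finset.card_powerset]
    exact_mod_cast this

theorem bernProb_noEmptyRectangle {n : ℕ} {q : ℝ} (h0 : 0 ≤ q) (h1 : q ≤ 1) (r m : ℕ) :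
    1 - 2 * 4 ^ n * (1 - q) ^ (r * m) ≤ bernProb q fun ω : Fin n × Fin n → Bool =>
      NoEmptyRectangle (fun a b => ω (a, b) = true) r m := by
  refine one_sub_le_bernProb ?_
  have e1 := bernProb_empty_rectangle_le h0 h1 (Finset.univ : Finset (Fin n))
    (Finset.univ : Finset (Fin n)) r m
  have e2 := bernProb_empty_rectangle_le h0 h1 (Finset.univ : Finset (Fin n))
    (Finset.univ : Finset (Fin n)) m r
  have h4 : (4 : ℝ) ^ n = 2 ^ n * 2 ^ n := by rw [← mul_pow]; norm_num
  rw [Finset.card_univ, Fintype.card_fin, ← h4] at e1 e2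
  rw [mul_comm m r] at e2
  refine (bernProb_mono h0 h1 ?_).trans ((bernProb_or_le h0 h1 _ _).trans
    ((add_le_add e1 e2).trans_eq (by ring)))
  intro ω hω
  simp only [NoEmptyRectangle, not_forall] at hω
  obtain ⟨X, Y, h, hXY⟩ := hω
  have hXY' : ∀ x ∈ X, ∀ y ∈ Y, ω (x, y) = false := by
    intro x hx y hy
    by_contra hne
    exact hXY ⟨x, hx, y, hy, by simpa using hne⟩
  rcases h with h | h
  · exact Or.inl ⟨X, Finset.subset_univ _, Y, Finset.subset_univ _, h.1, h.2, hXY'⟩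
  · exact Or.inr ⟨X, Finset.subset_univ _, Y, Finset.subset_univ _, h.1, h.2, hXY'⟩

/-- Applied with `T j` and `T' j` the leaves at `y j` and at `x j`: a matching edge between them
closes a 4-cycle with the reserved edge. Hall's criterion inside each block is combined with a union
bound over blocks; `(t + 1) / 2` is half of `t`, rounded up. -/
theorem bernProb_exists_matchings {n s t r : ℕ} {q : ℝ} (h0 : 0 ≤ q) (h1 : q ≤ 1) (hr : 0 < r)
    (J : Finset (Fin s)) (T T' : Fin s → Finset (Fin n)) (hT : ∀ j ∈ J, (T j).card = t)
    (hT' : ∀ j ∈ J, (T' j).card = t) :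
    1 - s * (2 * 4 ^ t * (1 - q) ^ (r * ((t + 1) / 2))) ≤
      bernProb q fun ω : Fin n × Fin n → Bool => ∀ j ∈ J, ∃ M : Finset (Fin n × Fin n),
        (∀ p ∈ M, p.1 ∈ T j ∧ p.2 ∈ T' j ∧ ω (p.1, p.2) = true) ∧
        Set.InjOn Prod.fst (M : Set (Fin n × Fin n)) ∧
        Set.InjOn Prod.snd (M : Set (Fin n × Fin n)) ∧ t ≤ M.card + r := by
  classical
  refine one_sub_le_bernProb ?_
  have hpt : ∀ j ∈ J, bernProb q (fun ω : Fin n × Fin n → Bool =>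
      (∃ X ⊆ T j, ∃ Y ⊆ T' j, r ≤ X.card ∧ (t + 1) / 2 ≤ Y.card ∧
        ∀ x ∈ X, ∀ y ∈ Y, ω (x, y) = false) ∨
      (∃ X ⊆ T j, ∃ Y ⊆ T' j, (t + 1) / 2 ≤ X.card ∧ r ≤ Y.card ∧
        ∀ x ∈ X, ∀ y ∈ Y, ω (x, y) = false)) ≤ 2 * 4 ^ t * (1 - q) ^ (r * ((t + 1) / 2)) := by
    intro j hj
    have e1 := bernProb_empty_rectangle_le h0 h1 (T j) (T' j) r ((t + 1) / 2)
    have e2 := bernProb_empty_rectangle_le h0 h1 (T j) (T' j) ((t + 1) / 2) r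
    have h4 : (4 : ℝ) ^ t = 2 ^ t * 2 ^ t := by rw [← mul_pow]; norm_num
    rw [hT j hj, hT' j hj, ← h4] at e1 e2
    rw [mul_comm _ r] at e2
    exact (bernProb_or_le h0 h1 _ _).trans ((add_le_add e1 e2).trans_eq (by ring))
  have hsum := (bernProb_exists_le h0 h1 J (fun j (ω : Fin n × Fin n → Bool) =>
      (∃ X ⊆ T j, ∃ Y ⊆ T' j, r ≤ X.card ∧ (t + 1) / 2 ≤ Y.card ∧
        ∀ x ∈ X, ∀ y ∈ Y, ω (x, y) = false) ∨
      (∃ X ⊆ T j, ∃ Y ⊆ T' j, (t + 1) / 2 ≤ X.card ∧ r ≤ Y.card ∧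
        ∀ x ∈ X, ∀ y ∈ Y, ω (x, y) = false))).trans
    (Finset.sum_le_card_nsmul J _ _ hpt)
  rw [nsmul_eq_mul] at hsum
  refine (bernProb_mono h0 h1 ?_).trans (hsum.trans (mul_le_mul_of_nonneg_right ?_ ?_))
  · intro ω hω
    by_contra hnot
    push Not at hnot
    refine hω fun j hj => ?_
    obtain ⟨ha, hb⟩ := hnot j hj
    refine exists_matching_of_no_empty_rectangle (fun a b => ω (a, b) = true) (T j) (T' j)
      (hT j hj) (hT' j hj) hr ?_ ?_
    · intro X hX Y hY hXr hYt
      obtain ⟨x, hx, y, hy, hxy⟩ := ha X hX Y hY hXr (by omega)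
      exact ⟨x, hx, y, hy, by simpa using hxy⟩
    · intro X hX Y hY hXr hYt
      obtain ⟨x, hx, y, hy, hxy⟩ := hb X hX Y hY (by omega) hYt
      exact ⟨x, hx, y, hy, by simpa using hxy⟩
  · exact_mod_cast (Finset.card_le_univ J).trans_eq (Fintype.card_fin s)
  · have : 0 ≤ 1 - q := by linarith
    positivity

/-- A pair `(j, l)` has two groups of at least `k` chances each, the pairs `(p.1, y l)` with `p` in
`Q j` and the pairs `(x j, p.2)` with `p` in `Q l`. The groups are disjoint because blocks avoid the
reserved vertices `x i`, whence the exponent `2 * k`, which decides the size of the saving. -/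
theorem bernProb_block_cover {n s k : ℕ} {q : ℝ} (h0 : 0 ≤ q) (h1 : q ≤ 1)
    (x y : Fin s → Fin n) (J : Finset (Fin s)) (Q : Fin s → Finset (Fin n × Fin n))
    (hQ : ∀ j ∈ J, ∀ p ∈ Q j, p.1 ∉ Set.range x)
    (hQ1 : ∀ j ∈ J, Set.InjOn Prod.fst (Q j : Set (Fin n × Fin n)))
    (hQ2 : ∀ j ∈ J, Set.InjOn Prod.snd (Q j : Set (Fin n × Fin n)))
    (hk : ∀ j ∈ J, k ≤ (Q j).card) :
    1 - s ^ 2 * (1 - q) ^ (2 * k) ≤ bernProb q fun ω : Fin n × Fin n → Bool =>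
      ∀ j ∈ J, ∀ l ∈ J, (∃ p ∈ Q j, ω (p.1, y l) = true) ∨ ∃ p ∈ Q l, ω (x j, p.2) = true := by
  classical
  refine one_sub_le_bernProb ?_
  have h := bernProb_exists_forall_false_le h0 h1 (J ×ˢ J)
    (fun jl => (Q jl.1).image (fun p => (p.1, y jl.2)) ∪ (Q jl.2).image (fun p => (x jl.1, p.2)))
    (k := 2 * k) (by
      rintro ⟨j, l⟩ hjl
      obtain ⟨hj, hl⟩ := Finset.mem_product.1 hjl
      simp only at hj hl
      rw [Finset.card_union_of_disjoint, Finset.card_image_of_injOn, Finset.card_image_of_injOn]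
      · have := hk j hj
        have := hk l hl
        simp only
        omega
      · intro p hp p' hp' h
        exact hQ2 l hl hp hp' (Prod.mk.inj h).2
      · intro p hp p' hp' h
        exact hQ1 j hj hp hp' (Prod.mk.inj h).1
      · rw [Finset.disjoint_left]
        intro z hz hz'
        obtain ⟨p, hp, rfl⟩ := Finset.mem_image.1 hz
        obtain ⟨p', hp', h⟩ := Finset.mem_image.1 hz'
        exact hQ j hj p hp ⟨j, congrArg Prod.fst h⟩)
  refine (bernProb_mono h0 h1 ?_).trans (h.trans (mul_le_mul_of_nonneg_right ?_ ?_))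
  · intro ω hω
    simp only [not_forall, not_or] at hω
    obtain ⟨j, hj, l, hl, h1, h2⟩ := hω
    refine ⟨(j, l), Finset.mem_product.2 ⟨hj, hl⟩, ?_⟩
    intro e he
    rcases Finset.mem_union.1 he with he | he
    · obtain ⟨p, hp, rfl⟩ := Finset.mem_image.1 he
      by_contra hne
      exact h1 ⟨p, hp, by simpa using hne⟩
    · obtain ⟨p, hp, rfl⟩ := Finset.mem_image.1 he
      by_contra hne
      exact h2 ⟨p, hp, by simpa using hne⟩
  · have : (J ×ˢ J).card ≤ s ^ 2 := by
      rw [Finset.card_product, sq]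
      have := (Finset.card_le_univ J).trans_eq (Fintype.card_fin s)
      exact Nat.mul_le_mul this this
    exact_mod_cast this
  · exact pow_nonneg (by linarith) _

/-- Three-stage exposure: reserved edges and stars, matchings inside the blocks, covering. -/
theorem bernProb_posetDim_add_le {n s r m t r₂ : ℕ} {q₁ q₂ q₃ : ℝ} (h₁ : 0 ≤ q₁) (h₁' : q₁ ≤ 1)
    (h₂ : 0 ≤ q₂) (h₂' : q₂ ≤ 1) (h₃ : 0 ≤ q₃) (h₃' : q₃ ≤ 1) (hr : 0 < r) (hr₂ : 0 < r₂)
    (hrt : r₂ < t) (hrs : r + s ≤ n) (hn : s + t * s + 2 * m ≤ n)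
    (hsmall : s * (2 * 4 ^ t * (1 - q₂) ^ (r₂ * ((t + 1) / 2))) +
      s ^ 2 * (1 - q₃) ^ (2 * (t - r₂)) ≤ 1) :
    1 - 2 * 4 ^ n * (1 - q₁) ^ (r * m) - (s * (2 * 4 ^ t * (1 - q₂) ^ (r₂ * ((t + 1) / 2))) +
      s ^ 2 * (1 - q₃) ^ (2 * (t - r₂))) ≤
      bernProb (1 - (1 - q₁) * ((1 - q₂) * (1 - q₃))) fun ω : Fin n × Fin n → Bool =>
        posetDim (bipartitePoset {e | ω e = false}) + s ≤ n + 3 * r + 2 := by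
  classical
  have p2 : (0 : ℝ) ≤ s * (2 * 4 ^ t * (1 - q₂) ^ (r₂ * ((t + 1) / 2))) := by
    have : 0 ≤ 1 - q₂ := by linarith
    positivity
  have p3 : (0 : ℝ) ≤ s ^ 2 * (1 - q₃) ^ (2 * (t - r₂)) := by
    have : 0 ≤ 1 - q₃ := by linarith
    positivity
  have e : 1 - (1 - q₁) * ((1 - q₂) * (1 - q₃)) =
      1 - (1 - q₁) * (1 - (1 - (1 - q₂) * (1 - q₃))) := by ring
  rw [e]
  -- The first layer is exposed against the union of the other two, which is split in the same way
  -- below. Edges found in one layer persist in the union, so structures chosen there remain valid.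
  refine bernProb_or_field_ge h₁ h₁' (by nlinarith) (by nlinarith) hsmall (by positivity) _ _
    (bernProb_noEmptyRectangle h₁ h₁' r m) ?_
  intro ω₁ hω₁
  obtain ⟨x, y, J, T, T', hx, hy, hxy, hJ, hT, hT', hd⟩ := hω₁.exists_stars hr hrs hn
  rw [← sub_sub]
  refine bernProb_or_field_ge h₂ h₂' h₃ h₃' (by linarith) p3 _ _
    (bernProb_exists_matchings h₂ h₂' hr₂ J T T' (fun j hj => (hT j hj).1)
      (fun j hj => (hT' j hj).1)) ?_
  intro ω₂ hω₂
  have : ∀ j : Fin s, ∃ M : Finset (Fin n × Fin n), j ∈ J →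
      ((∀ p ∈ M, p.1 ∈ T j ∧ p.2 ∈ T' j ∧ ω₂ (p.1, p.2) = true) ∧
        Set.InjOn Prod.fst (M : Set (Fin n × Fin n)) ∧
        Set.InjOn Prod.snd (M : Set (Fin n × Fin n)) ∧ t ≤ M.card + r₂) := by
    intro j
    by_cases hj : j ∈ J
    · obtain ⟨M, hM⟩ := hω₂ j hj
      exact ⟨M, fun _ => hM⟩
    · exact ⟨∅, fun h => absurd h hj⟩
  choose Q hQ using this
  refine (bernProb_block_cover h₃ h₃' x y J Q
    (fun j hj p hp => ((hT j hj).2 _ ((hQ j hj).1 p hp).1).1)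
    (fun j hj => (hQ j hj).2.1) (fun j hj => (hQ j hj).2.2.1) (k := t - r₂)
    (fun j hj => by have := (hQ j hj).2.2.2; omega)).trans (bernProb_mono h₃ h₃' ?_)
  intro ω₃ hω₃
  refine posetDim_le_of_blocks (m := m) (t := t) _ ?_ hr x y hx hy ?_ J Q ?_
    (fun j hj => (hQ j hj).2.1) (fun j hj => (hQ j hj).2.2.1) ?_ ?_ ?_ ?_ hn hJ
  · intro X Y hXY
    obtain ⟨a, ha, b, hb, hab⟩ := hω₁ X Y hXY
    exact ⟨a, ha, b, hb, by simp [hab]⟩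
  · intro j
    simp [hxy j]
  · intro j hj p hp
    obtain ⟨h1, h2, h3⟩ := (hQ j hj).1 p hp
    have h4 := (hT j hj).2 _ h1
    have h5 := (hT' j hj).2 _ h2
    exact ⟨by simp [h3], by simp [h5.2], by simp [h4.2], h4.1, h5.1⟩
  · intro i hi j hj hij p hp p' hp'
    obtain ⟨h1, h2, -⟩ := (hQ i hi).1 p hp
    obtain ⟨h1', h2', -⟩ := (hQ j hj).1 p' hp'
    obtain ⟨d1, d2⟩ := hd i hi j hj hij
    refine ⟨fun h => ?_, fun h => ?_⟩
    · exact Finset.disjoint_left.1 d1 h1 (h ▸ h1')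
    · exact Finset.disjoint_left.1 d2 h2 (h ▸ h2')
  · intro j hj
    rw [← Finset.card_pos]
    have := (hQ j hj).2.2.2
    omega
  · intro j hj
    rw [← (hT j hj).1, ← Finset.card_image_of_injOn (hQ j hj).2.1]
    refine Finset.card_le_card fun a ha => ?_
    obtain ⟨p, hp, rfl⟩ := Finset.mem_image.1 ha
    exact ((hQ j hj).1 p hp).1
  · intro j hj l hl _
    rcases hω₃ j hj l hl with ⟨p, hp, h⟩ | ⟨p, hp, h⟩
    · exact Or.inl ⟨p, hp, by simp [h]⟩
    · exact Or.inr ⟨p, hp, by simp [h]⟩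

/-! ### Choice of parameters for the denser ranges -/

theorem neg_log_one_sub_bounds {q : ℝ} (h0 : 0 < q) (h1 : q ≤ 1 / 2) :
    q ≤ -Real.log (1 - q) ∧ -Real.log (1 - q) ≤ 2 * q ∧ -Real.log (1 - q) ≤ 0.7 := by
  have hp : 0 < 1 - q := by linarith
  refine ⟨by linarith [Real.log_le_sub_one_of_pos hp], ?_, ?_⟩
  · have h := Real.one_sub_inv_le_log_of_pos hp
    have : (1 - q)⁻¹ ≤ 1 + 2 * q := by
      rw [inv_le_iff_one_le_mul₀ hp]
      nlinarith
    linarith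
  · have h := Real.log_le_log (by norm_num) (show (1 / 2 : ℝ) ≤ 1 - q by linarith)
    rw [one_div, Real.log_inv] at h
    linarith [Real.log_two_lt_d9]

theorem four_pow_le_exp (k : ℕ) : (4 : ℝ) ^ k ≤ Real.exp (1.4 * k) := by
  have h4 : (4 : ℝ) ≤ Real.exp 1.4 := by
    rw [← Real.log_le_iff_le_exp (by norm_num), show (4 : ℝ) = 2 ^ 2 by norm_num, Real.log_pow]
    have := Real.log_two_lt_d9
    push_cast
    linarith
  calc (4 : ℝ) ^ k ≤ Real.exp 1.4 ^ k := pow_le_pow_left₀ (by norm_num) h4 k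
    _ = Real.exp (1.4 * k) := by rw [← Real.exp_nat_mul]; ring_nf

set_option maxHeartbeats 1000000 in
/-- With high probability the dimension is below `n - S` when `q S` is large and
`(1 - q) ^ (2 n / S)` is polynomially smaller than `S⁻²`. -/
theorem exists_forall_bernProb_posetDim_lt (η : ℝ) (hη : 0 < η) :
    ∃ K : ℝ, ∀ (n : ℕ) (q S : ℝ), 0 < q → q ≤ 1 / 2 → K ≤ q * S → 0 < S →
      2.1 * Real.log S ≤ 2 * -Real.log (1 - q) * (n / S) →
      1 - η ≤ bernProb q fun ω : Fin n × Fin n → Bool =>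
        (posetDim (bipartitePoset {e | ω e = false}) : ℝ) < n - S := by
  obtain ⟨Λ, hΛ9, hΛη⟩ : ∃ Λ : ℝ, 10 ^ 9 ≤ Λ ∧ 10 * Real.exp (-(0.08 * Λ)) ≤ η := by
    refine ⟨max (10 ^ 9) (-(Real.log (η / 10)) / 0.08), le_max_left _ _, ?_⟩
    have h1 := le_max_right (10 ^ 9) (-(Real.log (η / 10)) / 0.08)
    rw [div_le_iff₀ (by norm_num)] at h1
    have h2 : Real.exp (-(0.08 * max (10 ^ 9) (-(Real.log (η / 10)) / 0.08))) ≤ η / 10 := by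
      rw [← Real.le_log_iff_exp_le (by positivity)]
      linarith
    linarith
  -- This makes `log S ≥ Λ`, so the three error terms, together at most `7.2 * exp (-0.08 * log S)`,
  -- stay below `η`; the summand `10 ^ 10` makes `1 / q` negligible compared with `S`.
  refine ⟨Real.exp Λ + 10 ^ 10, ?_⟩
  intro n q S hq0 hq1 hqS hS0 hlog
  obtain ⟨hl1, hl2, hl3⟩ := neg_log_one_sub_bounds hq0 hq1
  set ℓ := -Real.log (1 - q) with hℓ
  have hℓ0 : 0 < ℓ := hq0.trans_le hl1
  have hqexp : Real.exp (-ℓ) = 1 - q := by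
    rw [hℓ, neg_neg, Real.exp_log (by linarith)]
  have hSbig : Real.exp Λ + 10 ^ 10 ≤ S := hqS.trans (by nlinarith)
  set l := Real.log S with hl
  have hΛl : Λ ≤ l := by
    rw [hl, Real.le_log_iff_exp_le hS0]
    linarith [hSbig]
  have hSl : S = Real.exp l := (Real.exp_log hS0).symm
  have hS9 : (10 : ℝ) ^ 10 ≤ S := by linarith [Real.exp_pos Λ]
  set ν : ℝ := n / S with hν
  have hnν : (n : ℝ) = ν * S := by rw [hν]; field_simp
  have hl9 : (10 : ℝ) ^ 9 ≤ l := hΛ9.trans hΛl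
  have hℓν : 1.05 * l ≤ ℓ * ν := by linarith
  have hν0 : 0 ≤ ν := by positivity
  have hν15 : 1.5 * l ≤ ν := by linarith [mul_le_mul_of_nonneg_right hl3 hν0]
  have hqν : 0.5 * l ≤ q * ν := by linarith [mul_le_mul_of_nonneg_right hl2 hν0]
  have hnS : 10 ^ 9 * S ≤ n := by rw [hnν]; exact mul_le_mul_of_nonneg_right (by linarith) hS0.le
  -- The first two layers get the share `0.001` of `ℓ = -log (1 - q)`, so `r` and `m = 0.001 n` give
  -- an exponent of at least `0.001 * (r q) * m ≥ 2 n`, against `4 ^ n ≤ exp (1.4 n)`. Likewise `r₂`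
  -- gives `6 t` against `1.4 t`. With `s` about `1.001 S`, the excess `0.001 S` pays for `3 * r +
  -- 2`; taking `t` about `0.997 n / s` leaves room for `s` and `2 * m`.
  obtain ⟨r, hr1, hr2⟩ : ∃ r : ℕ, 2 * 10 ^ 6 / q ≤ r ∧ (r : ℝ) < 2 * 10 ^ 6 / q + 1 :=
    ⟨⌈2 * 10 ^ 6 / q⌉₊, Nat.le_ceil _, Nat.ceil_lt_add_one (by positivity)⟩
  obtain ⟨r₂, hr₂1, hr₂2⟩ : ∃ r : ℕ, 12000 / q ≤ r ∧ (r : ℝ) < 12000 / q + 1 :=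
    ⟨⌈12000 / q⌉₊, Nat.le_ceil _, Nat.ceil_lt_add_one (by positivity)⟩
  obtain ⟨m, hm1, hm2⟩ : ∃ m : ℕ, 0.001 * (n : ℝ) ≤ m ∧ (m : ℝ) < 0.001 * n + 1 :=
    ⟨⌈0.001 * (n : ℝ)⌉₊, Nat.le_ceil _, Nat.ceil_lt_add_one (by positivity)⟩
  obtain ⟨s, hs1, hs2⟩ : ∃ s : ℕ, 1.001 * S ≤ s ∧ (s : ℝ) < 1.001 * S + 1 :=
    ⟨⌈1.001 * S⌉₊, Nat.le_ceil _, Nat.ceil_lt_add_one (by positivity)⟩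
  have hs0 : (0 : ℝ) < s := by linarith
  obtain ⟨t, ht1, ht2⟩ : ∃ t : ℕ, (t : ℝ) ≤ 0.997 * n / s ∧ 0.997 * (n : ℝ) / s < t + 1 :=
    ⟨⌊0.997 * (n : ℝ) / s⌋₊, Nat.floor_le (by positivity), Nat.lt_floor_add_one _⟩
  rw [div_le_iff₀ hq0] at hr1 hr₂1
  have hrq : q * r ≤ 2 * 10 ^ 6 + 0.5 := by
    have : (r : ℝ) * q ≤ (2 * 10 ^ 6 / q + 1) * q := by gcongr
    rw [add_mul, div_mul_cancel₀ _ hq0.ne'] at this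
    linarith
  have hr₂q : q * r₂ ≤ 12000.5 := by
    have : (r₂ : ℝ) * q ≤ (12000 / q + 1) * q := by gcongr
    rw [add_mul, div_mul_cancel₀ _ hq0.ne'] at this
    linarith
  rw [le_div_iff₀ hs0] at ht1
  rw [div_lt_iff₀ hs0] at ht2
  have htν : 0.994 * ν ≤ t := by
    by_contra hlt
    push Not at hlt
    have h1 : (s : ℝ) ≤ 1.002 * S := by linarith
    have h2 : ((t : ℝ) + 1) * s ≤ (0.994 * ν + 1) * (1.002 * S) := by gcongr
    have h3 : 10 ^ 9 * S ≤ ν * S := hnν ▸ hnS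
    rw [hnν] at ht2
    linarith
  have hr₂ν : (r₂ : ℝ) ≤ 0.001 * ν := by
    by_contra hlt
    push Not at hlt
    have : q * (0.001 * ν) ≤ q * r₂ := by gcongr
    linarith
  have hr₂t : r₂ < t := by
    have : (r₂ : ℝ) < t := by linarith
    exact_mod_cast this
  have hr0 : 0 < r := by
    rcases Nat.eq_zero_or_pos r with h | h
    · rw [h] at hr1; norm_num at hr1
    · exact h
  have hr₂0 : 0 < r₂ := by
    rcases Nat.eq_zero_or_pos r₂ with h | h
    · rw [h] at hr₂1; norm_num at hr₂1
    · exact h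
  have h3r : 3 * (r : ℝ) + 2 < 0.001 * S := by
    by_contra hlt
    push Not at hlt
    have : q * (0.001 * S) ≤ q * (3 * (r : ℝ) + 2) := by gcongr
    linarith [Real.exp_pos Λ]
  have hrs : r + s ≤ n := by
    have : (r : ℝ) + s ≤ n := by linarith
    exact_mod_cast this
  have hnn : s + t * s + 2 * m ≤ n := by
    have : (s : ℝ) + t * s + 2 * m ≤ n := by linarith
    exact_mod_cast this
  have hpow : ∀ (a : ℝ) (k : ℕ), (1 - (1 - Real.exp (-(a * ℓ)))) ^ k =
      Real.exp (-(a * (ℓ * k))) := by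
    intro a k
    rw [sub_sub_cancel, ← Real.exp_nat_mul]
    ring_nf
  have hexp1 : Real.exp (-(0.08 * l)) ≤ Real.exp (-(0.08 * Λ)) := Real.exp_le_exp.2 (by linarith)
  have hexp2 : Real.exp (-(0.08 * l)) ≤ 0.1 := by
    have h1 := Real.add_one_le_exp (0.08 * l)
    rw [Real.exp_neg]
    exact inv_le_of_inv_le₀ (by norm_num) (by linarith)
  have T1 : 2 * 4 ^ n * (1 - (1 - Real.exp (-(0.001 * ℓ)))) ^ (r * m) ≤
      2 * Real.exp (-(0.08 * l)) := by
    rw [hpow, mul_assoc]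
    refine mul_le_mul_of_nonneg_left ?_ (by norm_num)
    refine (mul_le_mul_of_nonneg_right (four_pow_le_exp n) (Real.exp_pos _).le).trans ?_
    rw [← Real.exp_add, Real.exp_le_exp]
    have h1 : 2 * 10 ^ 6 * (0.001 * (n : ℝ)) ≤ r * q * m := by gcongr
    have h2 : r * q * m ≤ r * ℓ * (m : ℝ) := by gcongr
    have h3 : l ≤ S := by rw [hSl]; linarith [Real.add_one_le_exp l]
    rw [Nat.cast_mul]
    linarith
  have T2 : s * (2 * 4 ^ t * (1 - (1 - Real.exp (-(0.001 * ℓ)))) ^ (r₂ * ((t + 1) / 2))) ≤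
      4.1 * Real.exp (-(0.08 * l)) := by
    have h1 : 2 * (4 : ℝ) ^ t * (1 - (1 - Real.exp (-(0.001 * ℓ)))) ^ (r₂ * ((t + 1) / 2)) ≤
        2 * Real.exp (-(2 * l)) := by
      rw [hpow, mul_assoc]
      refine mul_le_mul_of_nonneg_left ?_ (by norm_num)
      refine (mul_le_mul_of_nonneg_right (four_pow_le_exp t) (Real.exp_pos _).le).trans ?_
      rw [← Real.exp_add, Real.exp_le_exp]
      have hh : (t : ℝ) ≤ 2 * ((t + 1) / 2 : ℕ) := by
        have : t ≤ 2 * ((t + 1) / 2) := by omega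
        exact_mod_cast this
      have h1 : 12000 * (t / 2 : ℝ) ≤ r₂ * q * ((t + 1) / 2 : ℕ) := by
        gcongr
        linarith
      have h2 : r₂ * q * (((t + 1) / 2 : ℕ) : ℝ) ≤ r₂ * ℓ * ((t + 1) / 2 : ℕ) := by gcongr
      rw [Nat.cast_mul]
      linarith
    refine (mul_le_mul_of_nonneg_left h1 hs0.le).trans ?_
    have h2 : (s : ℝ) ≤ 2 * Real.exp l := by rw [← hSl]; linarith
    have h3 : (s : ℝ) * (2 * Real.exp (-(2 * l))) ≤ 2 * Real.exp l * (2 * Real.exp (-(2 * l))) := by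
      gcongr
    refine h3.trans ?_
    have h4 : 2 * Real.exp l * (2 * Real.exp (-(2 * l))) = 4 * Real.exp (-l) := by
      rw [show 2 * Real.exp l * (2 * Real.exp (-(2 * l))) =
        4 * (Real.exp l * Real.exp (-(2 * l))) by ring, ← Real.exp_add]
      ring_nf
    rw [h4]
    have h5 : Real.exp (-l) ≤ Real.exp (-(0.08 * l)) := Real.exp_le_exp.2 (by linarith)
    linarith [Real.exp_pos (-(0.08 * l))]
  have T3 : s ^ 2 * (1 - (1 - Real.exp (-(0.998 * ℓ)))) ^ (2 * (t - r₂)) ≤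
      1.1 * Real.exp (-(0.08 * l)) := by
    rw [hpow]
    have h1 : (s : ℝ) ^ 2 ≤ 1.1 * Real.exp (2 * l) := by
      have : (s : ℝ) ≤ 1.002 * Real.exp l := by rw [← hSl]; linarith
      calc (s : ℝ) ^ 2 ≤ (1.002 * Real.exp l) ^ 2 := by gcongr
        _ = 1.002 ^ 2 * Real.exp (2 * l) := by
          rw [mul_pow, ← Real.exp_nat_mul]; norm_num
        _ ≤ 1.1 * Real.exp (2 * l) := by gcongr; norm_num
    -- The tight estimate, for which the third layer gets nearly all of `ℓ`: the losses leave `2 *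
    -- 0.998 * 0.993 * 1.05 > 2.08`, just enough to beat `s ^ 2`, of order `exp (2 * l)`.
    have h2 : Real.exp (-(0.998 * (ℓ * ((2 * (t - r₂) : ℕ) : ℝ)))) ≤ Real.exp (-(2.08 * l)) := by
      rw [Real.exp_le_exp]
      push_cast [Nat.cast_sub hr₂t.le]
      have : ℓ * (0.993 * ν) ≤ ℓ * (t - r₂) := by
        refine mul_le_mul_of_nonneg_left ?_ hℓ0.le
        linarith
      linarith
    calc (s : ℝ) ^ 2 * Real.exp (-(0.998 * (ℓ * ((2 * (t - r₂) : ℕ) : ℝ)))) ≤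
        1.1 * Real.exp (2 * l) * Real.exp (-(2.08 * l)) := by gcongr
      _ = 1.1 * Real.exp (-(0.08 * l)) := by
        rw [mul_assoc, ← Real.exp_add]; ring_nf
  have hq01 : ∀ a : ℝ, 0 ≤ a → 0 ≤ 1 - Real.exp (-(a * ℓ)) ∧ 1 - Real.exp (-(a * ℓ)) ≤ 1 := by
    intro a ha
    refine ⟨?_, by linarith [Real.exp_pos (-(a * ℓ))]⟩
    have : Real.exp (-(a * ℓ)) ≤ 1 := Real.exp_le_one_iff.2 (by nlinarith)
    linarith
  have key := bernProb_posetDim_add_le (n := n) (s := s) (r := r) (m := m) (t := t) (r₂ := r₂)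
    (hq01 0.001 (by norm_num)).1 (hq01 0.001 (by norm_num)).2 (hq01 0.001 (by norm_num)).1
    (hq01 0.001 (by norm_num)).2 (hq01 0.998 (by norm_num)).1 (hq01 0.998 (by norm_num)).2
    hr0 hr₂0 hr₂t hrs hnn (by linarith)
  have hprod : 1 - (1 - (1 - Real.exp (-(0.001 * ℓ)))) * ((1 - (1 - Real.exp (-(0.001 * ℓ)))) *
      (1 - (1 - Real.exp (-(0.998 * ℓ))))) = q := by
    rw [sub_sub_cancel, sub_sub_cancel, ← Real.exp_add, ← Real.exp_add,
      show -(0.001 * ℓ) + (-(0.001 * ℓ) + -(0.998 * ℓ)) = -ℓ by ring, hqexp]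
    ring
  rw [hprod] at key
  have hle : 1 - η ≤ 1 - 2 * 4 ^ n * (1 - (1 - Real.exp (-(0.001 * ℓ)))) ^ (r * m) -
      (s * (2 * 4 ^ t * (1 - (1 - Real.exp (-(0.001 * ℓ)))) ^ (r₂ * ((t + 1) / 2))) +
      s ^ 2 * (1 - (1 - Real.exp (-(0.998 * ℓ)))) ^ (2 * (t - r₂))) := by
    have := Real.exp_pos (-(0.08 * l))
    linarith
  refine hle.trans (key.trans (bernProb_mono hq0.le (by linarith) ?_))
  intro ω hω
  have : (posetDim (bipartitePoset {e | ω e = false}) : ℝ) + s ≤ n + 3 * r + 2 := by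
    exact_mod_cast hω
  linarith

/-! ### Second moments of empty squares -/

/-- Second moment method for the event that some `D p` contains no selected coordinate. -/
theorem second_moment_bernProb {E P : Type*} [Fintype E] [DecidableEq E] [Fintype P] {q : ℝ}
    (h0 : 0 ≤ q) (h1 : q ≤ 1) (D : P → Finset E) {k : ℕ} (hD : ∀ p, (D p).card = k) :
    (Fintype.card P * (1 - q) ^ k) ^ 2 ≤ bernProb q (fun ω => ∃ p, ∀ e ∈ D p, ω e = false) *
      ∑ p, ∑ p', (1 - q) ^ (D p ∪ D p').card := by
  classical
  let I : P → (E → Bool) → ℝ := fun p ω => if ∀ e ∈ D p, ω e = false then 1 else 0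
  let X : (E → Bool) → ℝ := fun ω => ∑ p, I p ω
  have hEX : ∑ ω, bernWeight q ω * X ω = Fintype.card P * (1 - q) ^ k := by
    simp only [X, Finset.mul_sum]
    rw [Finset.sum_comm, ← nsmul_eq_mul, ← Finset.card_univ]
    refine Finset.sum_eq_card_nsmul fun p _ => ?_
    rw [← hD p, ← bernProb_forall_false q (D p), bernProb]
    exact Finset.sum_congr rfl fun ω _ => by simp [I]
  have hEX2 : ∑ ω, bernWeight q ω * X ω ^ 2 = ∑ p, ∑ p', (1 - q) ^ (D p ∪ D p').card := by
    have : ∀ ω, bernWeight q ω * X ω ^ 2 = ∑ p, ∑ p', if ∀ e ∈ D p ∪ D p', ω e = false then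
        bernWeight q ω else 0 := by
      intro ω
      simp only [X]
      rw [sq, Finset.sum_mul_sum, Finset.mul_sum]
      refine Finset.sum_congr rfl fun p _ => ?_
      rw [Finset.mul_sum]
      refine Finset.sum_congr rfl fun p' _ => ?_
      have : (∀ e ∈ D p ∪ D p', ω e = false) ↔
          (∀ e ∈ D p, ω e = false) ∧ ∀ e ∈ D p', ω e = false := by
        simp only [Finset.mem_union, or_imp, forall_and]
      rw [if_congr this rfl rfl]
      by_cases ha : ∀ e ∈ D p, ω e = false
      · by_cases hb : ∀ e ∈ D p', ω e = false
        · rw [show I p ω = 1 from if_pos ha, show I p' ω = 1 from if_pos hb, if_pos ⟨ha, hb⟩]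
          ring
        · rw [show I p' ω = 0 from if_neg hb, if_neg fun h => hb h.2]
          ring
      · rw [show I p ω = 0 from if_neg ha, if_neg fun h => ha h.1]
        ring
    simp_rw [this]
    rw [Finset.sum_comm]
    refine Finset.sum_congr rfl fun p _ => ?_
    rw [Finset.sum_comm]
    refine Finset.sum_congr rfl fun p' _ => ?_
    rw [← bernProb_forall_false q (D p ∪ D p'), bernProb]
    exact Finset.sum_congr rfl fun ω _ => by congr
  rw [← hEX, ← hEX2, bernProb]
  -- Cauchy–Schwarz for `X` and the indicator of its support.
  refine Finset.sum_sq_le_sum_mul_sum_of_sq_le_mul _ (fun ω _ => ?_) (fun ω _ => ?_) fun ω _ => ?_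
  · split_ifs
    · exact bernWeight_nonneg h0 h1 ω
    · exact le_rfl
  · exact mul_nonneg (bernWeight_nonneg h0 h1 ω) (sq_nonneg _)
  · by_cases h : ∃ p, ∀ e ∈ D p, ω e = false
    · rw [if_pos h]; exact le_of_eq (by ring)
    · have : X ω = 0 := by
        refine Finset.sum_eq_zero fun p _ => ?_
        exact if_neg fun hp => h ⟨p, hp⟩
      rw [this]; simp

/-- Generating function of the number of agreements of two functions. -/
theorem sum_pow_card_agree (s g : ℕ) (x : ℝ) :
    ∑ f : Fin s → Fin g, ∑ f' : Fin s → Fin g, x ^ (Finset.univ.filter fun u => f u = f' u).card =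
      (g : ℝ) ^ s * (g - 1 + x) ^ s := by
  have h1 : ∀ f : Fin s → Fin g, ∑ f' : Fin s → Fin g,
      x ^ (Finset.univ.filter fun u => f u = f' u).card = (g - 1 + x) ^ s := by
    intro f
    have h2 : ∀ f' : Fin s → Fin g, x ^ (Finset.univ.filter fun u => f u = f' u).card =
        ∏ u, if f u = f' u then x else 1 := by
      intro f'
      rw [Finset.prod_ite]
      simp
    simp_rw [h2]
    rw [← Fintype.prod_sum (fun u c => if f u = c then x else 1)]
    have h3 : ∀ u, ∑ c : Fin g, (if f u = c then x else 1) = g - 1 + x := by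
      intro u
      have : ∀ c : Fin g, (if f u = c then x else 1) = 1 + if f u = c then x - 1 else 0 := by
        intro c; split_ifs <;> ring
      simp_rw [this]
      rw [Finset.sum_add_distrib, Finset.sum_ite_eq]
      simp
      ring
    simp_rw [h3]
    simp
  simp_rw [h1]
  simp

/-- Large balanced rectangles without selected coordinates. -/
def HasEmptySquare {n : ℕ} (ω : Fin n × Fin n → Bool) (k : ℕ) : Prop :=
  ∃ X Y : Finset (Fin n), k ≤ X.card ∧ k ≤ Y.card ∧ ∀ x ∈ X, ∀ y ∈ Y, ω (x, y) = false

/-- Only squares whose sides are transversals of `s` groups of `g` vertices are counted. A pair of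
sides is then a pair of functions, and agreements in different groups factorize. Summing over the
row sides gives a power depending on the number `j` of column agreements; the hypothesis `h` bounds
it by a sum of two geometric functions of `j`, so that the column sum is evaluated by the same
generating function. -/
theorem bernProb_hasEmptySquare {n s g : ℕ} {q c τ : ℝ} (h0 : 0 < q) (h1 : q < 1) (hg : 0 < g)
    (hsg : s * g ≤ n) (hτ : 0 ≤ τ)
    (h : ∀ j ≤ s, ((g : ℝ) - 1 + ((1 - q)⁻¹) ^ j) ^ s ≤
      g ^ s * (Real.exp c ^ j + τ * (g : ℝ) ^ j)) :
    1 ≤ bernProb q (fun ω : Fin n × Fin n → Bool => HasEmptySquare ω s) *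
      (Real.exp (s * (Real.exp c - 1) / g) + τ * 2 ^ s) := by
  classical

  have hp : 0 < 1 - q := by linarith
  have hb1 : 1 ≤ (1 - q)⁻¹ := (one_le_inv₀ hp).2 (by linarith)
  have hg0 : (0 : ℝ) < g := by exact_mod_cast hg
  have hg1 : (1 : ℝ) ≤ g := by exact_mod_cast hg
  let emb : Fin s → Fin g → Fin n := fun u c => Fin.castLE hsg (finProdFinEquiv (u, c))
  have hemb : ∀ u v c d, emb u c = emb v d → u = v ∧ c = d := by
    intro u v c d h
    have := finProdFinEquiv.injective (Fin.castLE_injective hsg h)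
    simpa using this
  let F := Fin s → Fin g
  let D : F × F → Finset (Fin n × Fin n) := fun p =>
    (Finset.univ : Finset (Fin s × Fin s)).image fun uv => (emb uv.1 (p.1 uv.1), emb uv.2 (p.2 uv.2))
  have hDc : ∀ p, (D p).card = s ^ 2 := by
    intro p
    rw [Finset.card_image_of_injective]
    · simp [sq]
    · rintro ⟨u, v⟩ ⟨u', v'⟩ huv
      simp only [Prod.mk.injEq] at huv
      simp [(hemb _ _ _ _ huv.1).1, (hemb _ _ _ _ huv.2).1]
  let a : F → F → ℕ := fun f f' => (Finset.univ.filter fun u => f u = f' u).card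
  have ha : ∀ f f', a f f' ≤ s := fun f f' =>
    (Finset.card_filter_le _ _).trans_eq (by simp)
  have hinter : ∀ p p', (D p ∩ D p').card ≤ a p.1 p'.1 * a p.2 p'.2 := by
    intro p p'
    have : D p ∩ D p' ⊆ ((Finset.univ.filter fun u => p.1 u = p'.1 u) ×ˢ
        (Finset.univ.filter fun u => p.2 u = p'.2 u)).image
        fun uv => (emb uv.1 (p.1 uv.1), emb uv.2 (p.2 uv.2)) := by
      intro e he
      obtain ⟨he1, he2⟩ := Finset.mem_inter.1 he
      obtain ⟨⟨u, v⟩, -, rfl⟩ := Finset.mem_image.1 he1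
      obtain ⟨⟨u', v'⟩, -, h⟩ := Finset.mem_image.1 he2
      simp only [Prod.mk.injEq] at h
      obtain ⟨rfl, h2⟩ := hemb _ _ _ _ h.1
      obtain ⟨rfl, h4⟩ := hemb _ _ _ _ h.2
      refine Finset.mem_image.2 ⟨(u', v'), ?_, rfl⟩
      simp [h2, h4]
    refine (Finset.card_le_card this).trans (Finset.card_image_le.trans ?_)
    rw [Finset.card_product]
  -- Two squares overlap in at most (row agreements) times (column agreements) cells, and each
  -- shared cell gains a factor `(1 - q)⁻¹`.
  have hunion : ∀ p p', (1 - q) ^ (D p ∪ D p').card ≤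
      (1 - q) ^ (2 * s ^ 2) * ((1 - q)⁻¹) ^ (a p.1 p'.1 * a p.2 p'.2) := by
    intro p p'
    have h2 : (D p ∪ D p').card + (D p ∩ D p').card = 2 * s ^ 2 := by
      rw [Finset.card_union_add_card_inter, hDc, hDc]; ring
    rw [← h2, pow_add, mul_assoc]
    refine le_mul_of_one_le_right (pow_nonneg hp.le _) ?_
    calc (1 : ℝ) = (1 - q) ^ (D p ∩ D p').card * ((1 - q)⁻¹) ^ (D p ∩ D p').card := by
          rw [← mul_pow, mul_inv_cancel₀ hp.ne', one_pow]
      _ ≤ _ := by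
          refine mul_le_mul_of_nonneg_left ?_ (pow_nonneg hp.le _)
          exact pow_le_pow_right₀ hb1 (hinter p p')
  have hsm := second_moment_bernProb h0.le h1.le D hDc
  have hcard : (Fintype.card (F × F) : ℝ) = (g : ℝ) ^ s * (g : ℝ) ^ s := by
    simp [F]
  set Pr := bernProb q (fun ω : Fin n × Fin n → Bool => HasEmptySquare ω s) with hPr
  have hPr0 : 0 ≤ Pr := bernProb_nonneg h0.le h1.le _
  have hPrle : bernProb q (fun ω => ∃ p, ∀ e ∈ D p, ω e = false) ≤ Pr := by
    refine bernProb_mono h0.le h1.le ?_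
    rintro ω ⟨p, hp⟩
    refine ⟨Finset.univ.image fun u => emb u (p.1 u), Finset.univ.image fun u => emb u (p.2 u),
      ?_, ?_, ?_⟩
    · rw [Finset.card_image_of_injective _ fun u v h => (hemb _ _ _ _ h).1]; simp
    · rw [Finset.card_image_of_injective _ fun u v h => (hemb _ _ _ _ h).1]; simp
    · intro x hx y hy
      obtain ⟨u, -, rfl⟩ := Finset.mem_image.1 hx
      obtain ⟨v, -, rfl⟩ := Finset.mem_image.1 hy
      exact hp _ (Finset.mem_image.2 ⟨(u, v), Finset.mem_univ _, rfl⟩)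
  have hS : ∑ p, ∑ p', (1 - q) ^ (D p ∪ D p').card ≤ (1 - q) ^ (2 * s ^ 2) *
      ∑ f₂ : F, ∑ f₂' : F, (g : ℝ) ^ s * (g - 1 + ((1 - q)⁻¹) ^ a f₂ f₂') ^ s := by
    refine (Finset.sum_le_sum fun p _ => Finset.sum_le_sum fun p' _ => hunion p p').trans_eq ?_
    simp_rw [← Finset.mul_sum]
    congr 1
    rw [Finset.mul_sum, Fintype.sum_prod_type_right]
    refine Finset.sum_congr rfl fun f₂ _ => ?_
    simp_rw [Fintype.sum_prod_type_right]
    rw [Finset.sum_comm, Finset.mul_sum]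
    refine Finset.sum_congr rfl fun f₂' _ => ?_
    rw [← sum_pow_card_agree s g]
    refine Finset.sum_congr rfl fun f _ => Finset.sum_congr rfl fun f' _ => ?_
    rw [← pow_mul, mul_comm]
  have hS2 : ∑ f₂ : F, ∑ f₂' : F, (g : ℝ) ^ s * (g - 1 + ((1 - q)⁻¹) ^ a f₂ f₂') ^ s ≤
      (g : ℝ) ^ s * (g ^ s * ((g : ℝ) ^ s * (g - 1 + Real.exp c) ^ s +
        τ * ((g : ℝ) ^ s * (g - 1 + g) ^ s))) := by
    rw [← sum_pow_card_agree s g, ← sum_pow_card_agree s g]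
    simp_rw [← Finset.mul_sum]
    refine mul_le_mul_of_nonneg_left ?_ (by positivity)
    rw [Finset.mul_sum, ← Finset.sum_add_distrib, Finset.mul_sum]
    refine Finset.sum_le_sum fun f₂ _ => ?_
    rw [Finset.mul_sum, ← Finset.sum_add_distrib, Finset.mul_sum]
    exact Finset.sum_le_sum fun f₂' _ => h _ (ha f₂ f₂')
  have hS3 : (g : ℝ) ^ s * (g ^ s * ((g : ℝ) ^ s * (g - 1 + Real.exp c) ^ s +
        τ * ((g : ℝ) ^ s * (g - 1 + g) ^ s))) ≤ ((g : ℝ) ^ s * (g : ℝ) ^ s) ^ 2 *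
        (Real.exp (s * (Real.exp c - 1) / g) + τ * 2 ^ s) := by
    have e1 : (g - 1 + Real.exp c) ^ s ≤ (g : ℝ) ^ s * Real.exp (s * (Real.exp c - 1) / g) := by
      have h3 : (g : ℝ) - 1 + Real.exp c ≤ g * Real.exp ((Real.exp c - 1) / g) := by
        have := Real.add_one_le_exp ((Real.exp c - 1) / g)
        calc (g : ℝ) - 1 + Real.exp c = g * ((Real.exp c - 1) / g + 1) := by field_simp; ring
          _ ≤ _ := by gcongr
      have h4 : 0 ≤ (g : ℝ) - 1 + Real.exp c := by linarith [Real.exp_pos c]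
      calc (g - 1 + Real.exp c) ^ s ≤ (g * Real.exp ((Real.exp c - 1) / g)) ^ s :=
            pow_le_pow_left₀ h4 h3 s
        _ = _ := by rw [mul_pow, ← Real.exp_nat_mul]; ring_nf
    have e2 : ((g : ℝ) - 1 + g) ^ s ≤ g ^ s * 2 ^ s := by
      rw [← mul_pow]
      exact pow_le_pow_left₀ (by linarith) (by linarith) s
    calc _ ≤ (g : ℝ) ^ s * (g ^ s * ((g : ℝ) ^ s * (g ^ s * Real.exp (s * (Real.exp c - 1) / g)) +
        τ * ((g : ℝ) ^ s * (g ^ s * 2 ^ s)))) := by gcongr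
      _ = _ := by ring
  rw [hcard] at hsm
  have hgs : 0 < ((g : ℝ) ^ s * (g : ℝ) ^ s) ^ 2 := by positivity
  have hps : 0 < (1 - q) ^ (2 * s ^ 2) := pow_pos hp _
  have hfin : ((g : ℝ) ^ s * (g : ℝ) ^ s) ^ 2 * (1 - q) ^ (2 * s ^ 2) ≤
      Pr * ((1 - q) ^ (2 * s ^ 2) * (((g : ℝ) ^ s * (g : ℝ) ^ s) ^ 2 *
        (Real.exp (s * (Real.exp c - 1) / g) + τ * 2 ^ s))) := by
    calc ((g : ℝ) ^ s * (g : ℝ) ^ s) ^ 2 * (1 - q) ^ (2 * s ^ 2)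
        = (g ^ s * g ^ s * (1 - q) ^ s ^ 2) ^ 2 := by ring
      _ ≤ _ := hsm
      _ ≤ Pr * ((1 - q) ^ (2 * s ^ 2) * (((g : ℝ) ^ s * (g : ℝ) ^ s) ^ 2 *
        (Real.exp (s * (Real.exp c - 1) / g) + τ * 2 ^ s))) := by
          refine mul_le_mul hPrle (hS.trans ?_) ?_ hPr0
          · exact mul_le_mul_of_nonneg_left (hS2.trans hS3) hps.le
          · exact Finset.sum_nonneg fun p _ => Finset.sum_nonneg fun p' _ => pow_nonneg hp.le _
  have : ((g : ℝ) ^ s * (g : ℝ) ^ s) ^ 2 * (1 - q) ^ (2 * s ^ 2) * 1 ≤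
      ((g : ℝ) ^ s * (g : ℝ) ^ s) ^ 2 * (1 - q) ^ (2 * s ^ 2) *
      (Pr * (Real.exp (s * (Real.exp c - 1) / g) + τ * 2 ^ s)) := by
    rw [mul_one]; exact hfin.trans_eq (by ring)
  exact le_of_mul_le_mul_left this (mul_pos hgs hps)

/-! ### Concentration of the largest empty square -/

/-- The bounded differences inequality for the moment generating function. -/
theorem sum_exp_bounded_differences {B : Type*} [Fintype B] (p : B → ℝ) (hp : ∀ b, 0 ≤ p b)
    (hp1 : ∑ b, p b = 1) {l : ℝ} (hl : |l| ≤ 1) (n : ℕ) (F : (Fin n → B) → ℝ)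
    (hF : ∀ ω i b, |F ω - F (Function.update ω i b)| ≤ 1) :
    ∑ ω : Fin n → B, (∏ i, p (ω i)) *
      Real.exp (l * (F ω - ∑ ω' : Fin n → B, (∏ i, p (ω' i)) * F ω')) ≤ Real.exp (n * l ^ 2) := by
  induction n with
  | zero => simp
  | succ n ih =>
    have hsplit : ∀ G : (Fin (n + 1) → B) → ℝ, ∑ ω : Fin (n + 1) → B, (∏ i, p (ω i)) * G ω =
        ∑ b, p b * ∑ ω : Fin n → B, (∏ i, p (ω i)) * G (Fin.cons b ω) := by
      intro G
      rw [← (Fin.consEquiv fun _ => B).sum_comp, Fintype.sum_prod_type]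
      refine Finset.sum_congr rfl fun b _ => ?_
      rw [Finset.mul_sum]
      refine Finset.sum_congr rfl fun ω _ => ?_
      simp [Fin.consEquiv, Fin.prod_univ_succ, mul_assoc]
    have hw1 : ∑ ω : Fin n → B, ∏ i, p (ω i) = 1 := by
      classical
      rw [← Fintype.prod_sum (fun (_ : Fin n) b => p b)]
      simp [hp1]
    have hw0 : ∀ ω : Fin n → B, 0 ≤ ∏ i, p (ω i) := fun ω => Finset.prod_nonneg fun i _ => hp _
    -- Conditional mean given the first coordinate. It varies by at most one, so its deviation from
    -- the overall mean `m` is centred and bounded by one, and `exp x ≤ 1 + x + x ^ 2` for `|x| ≤ 1`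
    -- yields the factor `1 + l ^ 2 ≤ exp (l ^ 2)`.
    let μ : B → ℝ := fun b => ∑ ω : Fin n → B, (∏ i, p (ω i)) * F (Fin.cons b ω)
    have hμ : ∀ b b', |μ b - μ b'| ≤ 1 := by
      intro b b'
      simp only [μ]
      rw [← Finset.sum_sub_distrib, ← hw1]
      refine (Finset.abs_sum_le_sum_abs _ _).trans (Finset.sum_le_sum fun ω _ => ?_)
      rw [← mul_sub, abs_mul, abs_of_nonneg (hw0 ω)]
      refine mul_le_of_le_one_right (hw0 ω) ?_
      have := hF (Fin.cons b ω) 0 b'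
      rwa [Fin.update_cons_zero] at this
    rw [hsplit, hsplit]
    set m := ∑ b, p b * μ b with hm
    have hmb : ∀ b, |μ b - m| ≤ 1 := by
      intro b
      have : μ b - m = ∑ b', p b' * (μ b - μ b') := by
        simp_rw [mul_sub]
        rw [Finset.sum_sub_distrib, ← Finset.sum_mul, hp1, one_mul]
      rw [this, ← hp1]
      refine (Finset.abs_sum_le_sum_abs _ _).trans (Finset.sum_le_sum fun b' _ => ?_)
      rw [abs_mul, abs_of_nonneg (hp b')]
      exact mul_le_of_le_one_right (hp b') (hμ b b')
    have hstep : ∀ b, ∑ ω : Fin n → B, (∏ i, p (ω i)) * Real.exp (l * (F (Fin.cons b ω) - m)) ≤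
        Real.exp (n * l ^ 2) * (1 + l * (μ b - m) + l ^ 2) := by
      intro b
      have h1 := ih (fun ω => F (Fin.cons b ω)) (by
        intro ω i c
        have := hF (Fin.cons b ω) i.succ c
        rwa [← Fin.cons_update] at this)
      have h2 : ∑ ω : Fin n → B, (∏ i, p (ω i)) * Real.exp (l * (F (Fin.cons b ω) - m)) =
          Real.exp (l * (μ b - m)) * ∑ ω : Fin n → B, (∏ i, p (ω i)) *
            Real.exp (l * (F (Fin.cons b ω) - μ b)) := by
        rw [Finset.mul_sum]
        refine Finset.sum_congr rfl fun ω _ => ?_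
        rw [mul_left_comm, ← Real.exp_add]
        ring_nf
      rw [h2, mul_comm]
      have h3 : |l * (μ b - m)| ≤ 1 := by
        rw [abs_mul]
        exact mul_le_one₀ hl (abs_nonneg _) (hmb b)
      have h4 : Real.exp (l * (μ b - m)) ≤ 1 + l * (μ b - m) + l ^ 2 := by
        have := (abs_le.1 (Real.abs_exp_sub_one_sub_id_le h3)).2
        have h5 : (l * (μ b - m)) ^ 2 ≤ l ^ 2 := by
          rw [mul_pow]
          refine mul_le_of_le_one_right (sq_nonneg l) ?_
          rw [← sq_abs]
          exact pow_le_one₀ (abs_nonneg _) (hmb b)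
        linarith
      exact mul_le_mul h1 h4 (Real.exp_pos _).le (Real.exp_pos _).le
    clear_value m
    calc ∑ b, p b * ∑ ω : Fin n → B, (∏ i, p (ω i)) * Real.exp (l * (F (Fin.cons b ω) - m))
        ≤ ∑ b, p b * (Real.exp (n * l ^ 2) * (1 + l * (μ b - m) + l ^ 2)) :=
          Finset.sum_le_sum fun b _ => mul_le_mul_of_nonneg_left (hstep b) (hp b)
      _ = Real.exp (n * l ^ 2) * ((1 + l ^ 2 - l * m) * ∑ b, p b + l * ∑ b, p b * μ b) := by
          rw [Finset.mul_sum, Finset.mul_sum, ← Finset.sum_add_distrib, Finset.mul_sum]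
          exact Finset.sum_congr rfl fun b _ => by ring
      _ = Real.exp (n * l ^ 2) * (1 + l ^ 2) := by rw [hp1, ← hm]; ring
      _ ≤ Real.exp (n * l ^ 2) * Real.exp (l ^ 2) := by
          refine mul_le_mul_of_nonneg_left ?_ (Real.exp_pos _).le
          linarith [Real.add_one_le_exp (l ^ 2)]
      _ = Real.exp ((n + 1 : ℕ) * l ^ 2) := by
          rw [← Real.exp_add]; push_cast; ring_nf

theorem bernProb_eq_sum_rows {n : ℕ} {B : Type*} [Fintype B] [DecidableEq B] (q : ℝ)
    (G : (Fin n × B → Bool) → ℝ) :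
    ∑ ω : Fin n × B → Bool, bernWeight q ω * G ω =
      ∑ ω : Fin n → B → Bool, (∏ i, bernWeight q (ω i)) * G fun e => ω e.1 e.2 := by
  rw [← (Equiv.curry (Fin n) B Bool).symm.sum_comp]
  refine Finset.sum_congr rfl fun ω _ => ?_
  congr 1
  simp [bernWeight, Fintype.prod_prod_type]

/-- If a function with row differences at most one is at least `a` with probability exceeding
`exp (-τ² / 4n)`, then it is at least `a - 2τ` with probability at least `1 - exp (-τ² / 4n)`. -/
theorem bernProb_boost {n : ℕ} (hn : 0 < n) {q a τ : ℝ} (h0 : 0 ≤ q) (h1 : q ≤ 1) (hτ : 0 ≤ τ)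
    (hτn : τ ≤ n) (F : (Fin n × Fin n → Bool) → ℝ)
    (hF : ∀ ω ω' : Fin n × Fin n → Bool, ∀ i, (∀ j k, j ≠ i → ω (j, k) = ω' (j, k)) →
      F ω ≤ F ω' + 1)
    (ha : Real.exp (-(τ ^ 2 / (4 * n))) < bernProb q fun ω => a ≤ F ω) :
    1 - Real.exp (-(τ ^ 2 / (4 * n))) ≤ bernProb q fun ω => a - 2 * τ ≤ F ω := by
  classical
  have hn0 : (0 : ℝ) < n := by exact_mod_cast hn
  set m := ∑ ω, bernWeight q ω * F ω with hm
  have hmgf : ∀ l : ℝ, |l| ≤ 1 →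
      ∑ ω, bernWeight q ω * Real.exp (l * (F ω - m)) ≤ Real.exp (n * l ^ 2) := by
    intro l hl
    have h := sum_exp_bounded_differences (fun b : Fin n → Bool => bernWeight q b)
      (bernWeight_nonneg h0 h1) (sum_bernWeight q) hl n (fun ω => F fun e => ω e.1 e.2) (by
        intro ω i b
        rw [abs_le]
        have e1 := hF (fun e => ω e.1 e.2) (fun e => Function.update ω i b e.1 e.2) i (by
          intro j k hj; simp [hj])
        have e2 := hF (fun e => Function.update ω i b e.1 e.2) (fun e => ω e.1 e.2) i (by
          intro j k hj; simp [hj])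
        constructor <;> linarith)
    rw [hm, bernProb_eq_sum_rows q F, bernProb_eq_sum_rows]
    exact h
  have htail : ∀ (σ : ℝ), |σ| = 1 → bernProb q (fun ω => τ ≤ σ * (F ω - m)) ≤
      Real.exp (-(τ ^ 2 / (4 * n))) := by
    intro σ hσ
    -- `τ / (2 n)` minimizes `n l ^ 2 - l τ`, with minimum `-τ ^ 2 / (4 n)`; `τ ≤ n` keeps it at
    -- most one.
    have hl0 : 0 ≤ τ / (2 * n) := by positivity
    have hl : |σ * (τ / (2 * n))| ≤ 1 := by
      rw [abs_mul, hσ, one_mul, abs_of_nonneg hl0, div_le_one (by positivity)]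
      linarith
    have hσ2 : σ ^ 2 = 1 := by rw [← sq_abs, hσ, one_pow]
    have h := hmgf _ hl
    have hle : Real.exp (τ ^ 2 / (2 * n)) * bernProb q (fun ω => τ ≤ σ * (F ω - m)) ≤
        ∑ ω, bernWeight q ω * Real.exp (σ * (τ / (2 * n)) * (F ω - m)) := by
      rw [bernProb, Finset.mul_sum]
      refine Finset.sum_le_sum fun ω _ => ?_
      have hw := bernWeight_nonneg h0 h1 ω
      split_ifs with hω
      · rw [mul_comm]
        refine mul_le_mul_of_nonneg_left (Real.exp_le_exp.2 ?_) hw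
        have := mul_le_mul_of_nonneg_left hω hl0
        calc τ ^ 2 / (2 * n) = τ / (2 * n) * τ := by ring
          _ ≤ _ := this
          _ = _ := by ring
      · rw [mul_zero]
        exact mul_nonneg hw (Real.exp_pos _).le
    have h2 := hle.trans h
    have e : (n : ℝ) * (σ * (τ / (2 * n))) ^ 2 = τ ^ 2 / (2 * n) + -(τ ^ 2 / (4 * n)) := by
      rw [mul_pow, hσ2]
      field_simp
      ring
    rw [e, Real.exp_add] at h2
    exact le_of_mul_le_mul_left h2 (Real.exp_pos _)
  -- Otherwise the upper tail would contradict `ha`. The mean thus exceeds `a - τ`, and the lower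
  -- tail costs another `τ`.
  have hma : a < m + τ := by
    by_contra hle
    push Not at hle
    have := (bernProb_mono h0 h1 (fun ω (hω : a ≤ F ω) =>
      show τ ≤ 1 * (F ω - m) by linarith)).trans (htail 1 abs_one)
    linarith
  refine one_sub_le_bernProb ((bernProb_mono h0 h1 ?_).trans (htail (-1) (by simp)))
  intro ω hω
  push Not at hω
  linarith

open Classical in
/-- The largest side of a balanced rectangle without selected coordinates. -/
noncomputable def maxEmptySquare {n : ℕ} (ω : Fin n × Fin n → Bool) : ℕ :=
  ((Finset.univ : Finset (Finset (Fin n) × Finset (Fin n))).filter fun p =>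
    ∀ x ∈ p.1, ∀ y ∈ p.2, ω (x, y) = false).sup fun p => min p.1.card p.2.card

theorem hasEmptySquare_iff {n : ℕ} (ω : Fin n × Fin n → Bool) (k : ℕ) :
    HasEmptySquare ω k ↔ k ≤ maxEmptySquare ω := by
  classical
  constructor
  · rintro ⟨X, Y, hX, hY, h⟩
    refine (le_min hX hY).trans ?_
    exact Finset.le_sup (f := fun p : Finset (Fin n) × Finset (Fin n) => min p.1.card p.2.card)
      (b := (X, Y)) (by simpa using h)
  · intro h
    obtain ⟨p, hp, hpe⟩ := Finset.exists_mem_eq_sup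
      ((Finset.univ : Finset (Finset (Fin n) × Finset (Fin n))).filter fun p =>
        ∀ x ∈ p.1, ∀ y ∈ p.2, ω (x, y) = false) ⟨(∅, ∅), by simp⟩
      (fun p => min p.1.card p.2.card)
    have h' : k ≤ min p.1.card p.2.card := h.trans_eq (by rw [← hpe]; rfl)
    exact ⟨p.1, p.2, h'.trans (min_le_left _ _), h'.trans (min_le_right _ _),
      (Finset.mem_filter.1 hp).2⟩

/-- Deleting the changed row from a largest square leaves an empty square; this is the bounded
difference needed for `bernProb_boost`. -/
theorem maxEmptySquare_le_add_one {n : ℕ} (ω ω' : Fin n × Fin n → Bool) (i : Fin n)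
    (h : ∀ j k, j ≠ i → ω (j, k) = ω' (j, k)) : maxEmptySquare ω ≤ maxEmptySquare ω' + 1 := by
  classical
  obtain ⟨X, Y, hX, hY, hXY⟩ := (hasEmptySquare_iff ω _).2 le_rfl
  have : HasEmptySquare ω' (maxEmptySquare ω - 1) := by
    refine ⟨X.erase i, Y, ?_, by omega, ?_⟩
    · have := Finset.pred_card_le_card_erase (s := X) (a := i)
      omega
    · intro x hx y hy
      obtain ⟨hxi, hx⟩ := Finset.mem_erase.1 hx
      rw [← h x y hxi]
      exact hXY x hx y hy
  have := (hasEmptySquare_iff ω' _).1 this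
  omega

/-! ### The sparse range -/

/-- An empty square and an almost perfect matching outside it. -/
theorem posetDim_add_le_of_hasEmptySquare {n k r m : ℕ} {ω : Fin n × Fin n → Bool}
    (hsq : HasEmptySquare ω k) (hU : NoEmptyRectangle (fun a b => ω (a, b) = true) r m)
    (hr : 0 < r) (hn : k + 2 * m ≤ n) :
    posetDim (bipartitePoset {e | ω e = false}) + k ≤ n + r + 2 := by
  classical
  obtain ⟨X', Y', hX', hY', hXY'⟩ := hsq
  obtain ⟨X, hXs, hXc⟩ := Finset.exists_subset_card_eq hX'
  obtain ⟨Y, hYs, hYc⟩ := Finset.exists_subset_card_eq hY'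
  have hX₀ := Finset.card_sdiff_add_card_eq_card (Finset.subset_univ X)
  have hY₀ := Finset.card_sdiff_add_card_eq_card (Finset.subset_univ Y)
  rw [Finset.card_univ, Fintype.card_fin] at hX₀ hY₀
  obtain ⟨M, hM, hM1, hM2, hMc⟩ := hU.exists_matching hr (Finset.univ \ X) (Finset.univ \ Y)
    (by omega) (by omega)
  have hW := card_sdiff_image_of_injOn hM1 fun p hp => (hM p hp).1
  have hW' := card_sdiff_image_of_injOn hM2 fun p hp => (hM p hp).2.1
  have hMR : ∀ p ∈ M, p ∉ {e | ω e = false} := fun p hp => by simp [(hM p hp).2.2]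
  -- With `id` as augmentation the chain graphs are plain double stars; no edge lies inside `X × Y`,
  -- so stars outside the square cover everything.
  have key := posetDim_le_of_matching {e | ω e = false} M id
    ((Finset.univ \ X) \ M.image Prod.fst) ((Finset.univ \ Y) \ M.image Prod.snd) hMR
    (fun p hp => ⟨hMR p hp, hMR p hp, hMR p hp⟩) (by
      intro a a' haa
      by_cases h1 : a ∈ M.image Prod.fst
      · obtain ⟨p, hp, rfl⟩ := Finset.mem_image.1 h1
        exact Or.inr (Or.inr ⟨p, hp, Or.inl rfl⟩)
      by_cases h2 : a' ∈ M.image Prod.snd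
      · obtain ⟨p, hp, rfl⟩ := Finset.mem_image.1 h2
        exact Or.inr (Or.inr ⟨p, hp, Or.inr (Or.inl rfl)⟩)
      by_cases h3 : a ∈ X
      · by_cases h4 : a' ∈ Y
        · exact absurd (hXY' a (hXs h3) a' (hYs h4)) haa
        · exact Or.inr (Or.inl (by simp only [Finset.mem_sdiff, Finset.mem_univ, true_and]; exact ⟨h4, h2⟩))
      · exact Or.inl (by simp only [Finset.mem_sdiff, Finset.mem_univ, true_and]; exact ⟨h3, h1⟩))
  omega

/-- The overlap of two random squares contributes little to the second moment. -/
theorem overlap_pow_le {δ L ℓ : ℝ} {s g j : ℕ} (hδ0 : 0 < δ) (hδ1 : δ < 1) (hℓ : 0 < ℓ)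
    (hg : 0 < g) (hLδ : 6 ≤ δ * L) (hs : s * ℓ ≤ (2 - δ) * L)
    (hlogg : L - δ * L / 4 ≤ Real.log g) (hj : j ≤ s) :
    ((g : ℝ) - 1 + Real.exp ℓ ^ j) ^ s ≤
      g ^ s * (Real.exp (s * Real.exp 8 * ℓ / g) ^ j + Real.exp (-(2 * s)) * (g : ℝ) ^ j) := by
  have hg0 : (0 : ℝ) < g := by exact_mod_cast hg
  have hg1 : (1 : ℝ) ≤ g := by exact_mod_cast hg
  have hL0 : 0 < L := by
    by_contra h
    push Not at h
    nlinarith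
  have hexp : Real.exp ℓ ^ j = Real.exp (ℓ * j) := by rw [← Real.exp_nat_mul]; ring_nf
  rw [hexp]
  set y := ℓ * j with hy
  have hj' : (j : ℝ) ≤ s := by exact_mod_cast hj
  have hyY : y ≤ (2 - δ) * L := by
    refine le_trans ?_ hs
    rw [hy, mul_comm]
    gcongr
  have hy0 : 0 ≤ y := by positivity
  -- For small overlap `exp y - 1` is at most `exp 8 * y`, giving the first geometric term. For
  -- larger overlap, with `a = log g`, an exponent `u` is sought with `1 + exp (y - a) ≤ exp u` and
  -- `s (u + 2) ≤ j a`, giving the second. Since `s ℓ ≤ (2 - δ) L`, the latter follows from `(2 - δ)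
  -- L (u + 2) ≤ y a`. The cutoff 8 works because `8 * 0.75 ≥ 2 * 2.7`.
  rcases le_or_gt y 8 with h8 | h8
  · have h1 : (g : ℝ) - 1 + Real.exp y ≤ g * Real.exp ((Real.exp 8 * ℓ * j) / g) := by
      have h2 : Real.exp y - 1 ≤ Real.exp 8 * ℓ * j := by
        have h3 := Real.one_sub_le_exp_neg y
        have h4 : Real.exp y * Real.exp (-y) = 1 := by rw [← Real.exp_add]; simp
        have h5 : Real.exp y * (1 - y) ≤ 1 := by
          exact (mul_le_mul_of_nonneg_left h3 (Real.exp_pos y).le).trans_eq h4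
        have h6 : Real.exp y * y ≤ Real.exp 8 * y :=
          mul_le_mul_of_nonneg_right (Real.exp_le_exp.2 h8) hy0
        rw [mul_assoc, ← hy]
        linarith
      have := Real.add_one_le_exp ((Real.exp 8 * ℓ * j) / g)
      calc (g : ℝ) - 1 + Real.exp y ≤ g * ((Real.exp 8 * ℓ * j) / g + 1) := by
            rw [mul_add, mul_div_cancel₀ _ hg0.ne']; linarith
        _ ≤ _ := by gcongr
    have h2 : 0 ≤ (g : ℝ) - 1 + Real.exp y := by linarith [Real.exp_pos y]
    calc ((g : ℝ) - 1 + Real.exp y) ^ s ≤ (g * Real.exp ((Real.exp 8 * ℓ * j) / g)) ^ s :=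
          pow_le_pow_left₀ h2 h1 s
      _ = g ^ s * Real.exp (s * Real.exp 8 * ℓ / g) ^ j := by
          rw [mul_pow, ← Real.exp_nat_mul, ← Real.exp_nat_mul]; ring_nf
      _ ≤ _ := by
          refine mul_le_mul_of_nonneg_left ?_ (by positivity)
          have : 0 ≤ Real.exp (-(2 * (s : ℝ))) * (g : ℝ) ^ j := by positivity
          linarith
  · set a := Real.log g with ha
    have hga : (g : ℝ) = Real.exp a := (Real.exp_log hg0).symm
    obtain ⟨u, hu1, hu2, hu0⟩ : ∃ u, 1 + Real.exp (y - a) ≤ Real.exp u ∧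
        (2 - δ) * L * (u + 2) ≤ y * a ∧ 0 ≤ u := by
      have hlog2 : (2 : ℝ) ≤ Real.exp 0.7 := by
        rw [← Real.log_le_iff_le_exp (by norm_num)]
        linarith [Real.log_two_lt_d9]
      have ha34 : 0.75 * L ≤ a := by nlinarith
      rcases le_or_gt y a with hya | hya
      · refine ⟨0.7, ?_, ?_, by norm_num⟩
        · have : Real.exp (y - a) ≤ 1 := Real.exp_le_one_iff.2 (by linarith)
          linarith
        · have h1 : 8 * (0.75 * L) ≤ y * a := by gcongr
          nlinarith
      · refine ⟨y - a + 0.7, ?_, ?_, by linarith⟩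
        · rw [Real.exp_add]
          have : 1 ≤ Real.exp (y - a) := Real.one_le_exp (by linarith)
          nlinarith
        -- The worst case is full overlap `y = (2 - δ) L`, where the condition becomes `(2 - δ) L +
        -- 2.7 ≤ 2 a`. As `a` is at least `L - δ L / 4`, this holds, and it is what limits the side
        -- to `(2 - δ) L / ℓ`.
        · have h1 : y * ((2 - δ) * L - a) ≤ (2 - δ) * L * ((2 - δ) * L - a) :=
            mul_le_mul_of_nonneg_right hyY (by linarith)
          have h2 : (2 - δ) * L * 2.7 ≤ (2 - δ) * L * (2 * a - (2 - δ) * L) :=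
            mul_le_mul_of_nonneg_left (by linarith) (by nlinarith)
          linarith
    have hsu : s * u ≤ j * a - 2 * s := by
      have h1 : s * ℓ * (u + 2) ≤ y * a :=
        (mul_le_mul_of_nonneg_right hs (by linarith)).trans hu2
      have h2 : ℓ * (s * (u + 2)) ≤ ℓ * (j * a) := by
        rw [hy] at h1
        linarith
      have := le_of_mul_le_mul_left h2 hℓ
      linarith
    calc ((g : ℝ) - 1 + Real.exp y) ^ s ≤ (g * Real.exp u) ^ s := by
          refine pow_le_pow_left₀ (by linarith [Real.exp_pos y]) ?_ s
          have : (g : ℝ) * (1 + Real.exp (y - a)) ≤ g * Real.exp u := by gcongr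
          have h2 : (g : ℝ) * Real.exp (y - a) = Real.exp y := by
            rw [hga, ← Real.exp_add]; ring_nf
          linarith
      _ = g ^ s * Real.exp (s * u) := by rw [mul_pow, ← Real.exp_nat_mul]
      _ ≤ g ^ s * (Real.exp (-(2 * s)) * (g : ℝ) ^ j) := by
          refine mul_le_mul_of_nonneg_left ?_ (by positivity)
          have : (g : ℝ) ^ j = Real.exp (j * a) := by rw [hga, ← Real.exp_nat_mul]
          rw [this, ← Real.exp_add]
          exact Real.exp_le_exp.2 (by linarith)
      _ ≤ _ := by
          refine mul_le_mul_of_nonneg_left ?_ (by positivity)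
          have : 0 ≤ Real.exp (s * Real.exp 8 * ℓ / g) ^ j := by positivity
          linarith

theorem exists_forall_log_growth (ε : ℝ) (hε : 0 < ε) (c : ℝ) (hc : 0 < c) (K₀ : ℝ) :
    ∃ K, K₀ ≤ K ∧ ∀ L, K ≤ L → Real.log (4 * L) ≤ ε * L ∧ L ^ 2 ≤ c * Real.exp L := by
  have h1 : ∀ᶠ L : ℝ in Filter.atTop, Real.log L ≤ ε / 2 * L := by
    filter_upwards [Real.isLittleO_log_id_atTop.bound (half_pos hε), Filter.eventually_ge_atTop 0]
      with L hL hL0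
    have := (le_abs_self _).trans hL
    simpa [abs_of_nonneg hL0] using this
  have h2 : ∀ᶠ L : ℝ in Filter.atTop, L ^ 2 * Real.exp (-L) < c :=
    (Real.tendsto_pow_mul_exp_neg_atTop_nhds_zero 2).eventually_lt_const hc
  obtain ⟨K, hK⟩ := Filter.eventually_atTop.1 (h1.and (h2.and
    ((Filter.eventually_ge_atTop (2 * Real.log 4 / ε)).and (Filter.eventually_gt_atTop 0))))
  refine ⟨max K₀ K, le_max_left _ _, fun L hL => ?_⟩
  obtain ⟨e1, e2, e3, e4⟩ := hK L ((le_max_right _ _).trans hL)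
  constructor
  · rw [Real.log_mul (by norm_num) e4.ne']
    rw [div_le_iff₀ hε] at e3
    linarith
  · rw [Real.exp_neg] at e2
    have := Real.exp_pos L
    rw [mul_inv_lt_iff₀ this] at e2
    exact e2.le

/-- The second moment bound for squares of nearly optimal side. -/
theorem exists_square_second_moment {ε q L : ℝ} {n : ℕ} (hε0 : 0 < ε) (hε1 : ε < 1) (hq0 : 0 < q)
    (hqn0 : 0 < q * n) (hL : L = Real.log (q * n)) (hlog4 : Real.log (4 * L) ≤ ε / 8 * L)
    (hL100 : 100 ≤ L) (hεL : 100 ≤ ε * L) (hqε : 100 * q ≤ ε)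
    (hL2 : 4096 * Real.exp 8 * L ^ 2 ≤ q * n) :
    ∃ s : ℕ, (2 - 0.625 * ε) * L / q - 1 ≤ s ∧ L ≤ s ∧ s * q ≤ 2 * L ∧
      1 ≤ bernProb q (fun ω : Fin n × Fin n → Bool => HasEmptySquare ω s) *
        (Real.exp (256 * Real.exp 8 * L ^ 4 / (q ^ 3 * n ^ 2)) + Real.exp (-s)) := by
  have hL0 : 0 < L := by linarith
  have hn0 : (0 : ℝ) < n := pos_of_mul_pos_right hqn0 hq0.le
  have hq12 : q ≤ 1 / 2 := by linarith
  have he8 : 1 ≤ Real.exp 8 := Real.one_le_exp (by norm_num)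
  obtain ⟨hl1, hl2, -⟩ := neg_log_one_sub_bounds hq0 hq12
  obtain ⟨ℓ, hℓ⟩ : ∃ ℓ, ℓ = -Real.log (1 - q) := ⟨_, rfl⟩
  rw [← hℓ] at hl1 hl2
  have hℓ0 : 0 < ℓ := hq0.trans_le hl1
  have hqexp : (1 - q)⁻¹ = Real.exp ℓ := by
    rw [hℓ, Real.exp_neg, Real.exp_log (by linarith)]
  have hlfine : ℓ * (1 - 2 * q) ≤ q := by
    have h1 := Real.one_sub_inv_le_log_of_pos (show 0 < 1 - q by linarith)
    have hq2 : q ^ 2 * q ≤ q ^ 2 * (1 / 2) := mul_le_mul_of_nonneg_left hq12 (sq_nonneg q)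
    have h2 : (1 - q)⁻¹ ≤ 1 + q + 2 * q ^ 2 := by
      rw [inv_le_iff_one_le_mul₀ (by linarith)]
      linarith
    have h3 : ℓ ≤ q + 2 * q ^ 2 := by linarith
    have h4 : ℓ * (1 - 2 * q) ≤ (q + 2 * q ^ 2) * (1 - 2 * q) :=
      mul_le_mul_of_nonneg_right h3 (by linarith)
    have : 0 ≤ q ^ 2 * q := by positivity
    linarith
  -- The overlap estimate is used with `δ = ε / 2`; replacing `ℓ` by `q` costs a further `0.125 ε`
  -- since `100 q ≤ ε`.
  obtain ⟨s, hs1, hs2⟩ : ∃ s : ℕ, (s : ℝ) ≤ (2 - ε / 2) * L / ℓ ∧ (2 - ε / 2) * L / ℓ < s + 1 :=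
    ⟨⌊(2 - ε / 2) * L / ℓ⌋₊, Nat.floor_le (by
      have : 0 ≤ (2 - ε / 2) := by linarith
      positivity), Nat.lt_floor_add_one _⟩
  rw [le_div_iff₀ hℓ0] at hs1
  rw [div_lt_iff₀ hℓ0] at hs2
  have hqL : 100 * q * L ≤ ε * L := mul_le_mul_of_nonneg_right hqε hL0.le
  have hεqL : 0 ≤ ε * q * L := by positivity
  have hslow : (2 - 0.625 * ε) * L / q - 1 ≤ s := by
    rw [sub_le_iff_le_add, div_le_iff₀ hq0]
    have h1 : (2 - ε / 2) * L * (1 - 2 * q) ≤ (s + 1) * ℓ * (1 - 2 * q) :=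
      mul_le_mul_of_nonneg_right hs2.le (by linarith)
    have h2 : (s + 1) * (ℓ * (1 - 2 * q)) ≤ (s + 1) * q := by gcongr
    linarith
  have hsup : s * q ≤ 2 * L := by
    have : s * q ≤ s * ℓ := by gcongr
    linarith
  have hsL : L ≤ s := by
    refine le_trans ?_ hslow
    rw [le_sub_iff_add_le, le_div_iff₀ hq0]
    have h1 : (L + 1) * q ≤ (L + 1) * (1 / 2) := by gcongr
    have h2 : ε * L ≤ 1 * L := by gcongr
    linarith
  have hs0 : (0 : ℝ) < s := by linarith
  have hLL : 100 * L ≤ L ^ 2 := by rw [sq]; gcongr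
  have h8L : 4096 * L ^ 2 ≤ 4096 * Real.exp 8 * L ^ 2 := by
    have : 1 * L ^ 2 ≤ Real.exp 8 * L ^ 2 := by gcongr
    linarith
  have hsn : 2 * (s : ℝ) ≤ n := by
    have : q * (2 * s) ≤ q * n := by linarith
    exact le_of_mul_le_mul_left this hq0
  obtain ⟨g, hg1, hg2⟩ : ∃ g : ℕ, (g : ℝ) ≤ n / s ∧ (n : ℝ) / s < g + 1 :=
    ⟨⌊(n : ℝ) / s⌋₊, Nat.floor_le (by positivity), Nat.lt_floor_add_one _⟩
  rw [le_div_iff₀ hs0] at hg1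
  rw [div_lt_iff₀ hs0] at hg2
  have hg0' : 0 < g := by
    rcases Nat.eq_zero_or_pos g with h0 | h0
    · rw [h0, Nat.cast_zero, zero_add, one_mul] at hg2
      linarith
    · exact h0
  have hg1' : (1 : ℝ) ≤ g := by exact_mod_cast hg0'
  have hg0 : (0 : ℝ) < g := by linarith
  have hgs : (n : ℝ) ≤ 2 * (g * s) := by
    have : 1 * (s : ℝ) ≤ g * s := by gcongr
    linarith
  have hgL : q * n ≤ 4 * L * g := by
    have h1 : q * n ≤ q * (2 * (g * s)) := by gcongr
    have h2 : (g : ℝ) * (s * q) ≤ g * (2 * L) := by gcongr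
    linarith
  have hlogg : L - (ε / 2) * L / 4 ≤ Real.log g := by
    have h1 : L ≤ Real.log (4 * L * g) := hL ▸ Real.log_le_log hqn0 (hL ▸ hgL)
    rw [Real.log_mul (by positivity) hg0.ne'] at h1
    linarith
  have hsg : s * g ≤ n := by
    have : (s : ℝ) * g ≤ n := by linarith
    exact_mod_cast this
  refine ⟨s, hslow, hsL, hsup, ?_⟩
  have hPr1 := bernProb_hasEmptySquare (n := n) (s := s) (g := g) (q := q)
    (c := s * Real.exp 8 * ℓ / g)
    (τ := Real.exp (-(2 * s))) hq0 (by linarith) hg0' hsg (Real.exp_pos _).le (by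
      intro j hj
      rw [hqexp]
      exact overlap_pow_le (δ := ε / 2) (L := L) (by linarith) (by linarith) hℓ0 hg0'
        (by linarith) hs1 hlogg hj)
  refine hPr1.trans (mul_le_mul_of_nonneg_left (add_le_add (Real.exp_le_exp.2 ?_) ?_)
    (bernProb_nonneg hq0.le (by linarith) _))
  · have hc0 : 0 ≤ s * Real.exp 8 * ℓ / g := by positivity
    have hsℓ : s * ℓ ≤ 2 * (2 * L) := by
      have : s * ℓ ≤ s * (2 * q) := by gcongr
      linarith
    have hc1 : s * Real.exp 8 * ℓ / g ≤ 1 := by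
      rw [div_le_one hg0]
      have h1 : Real.exp 8 * (s * ℓ) ≤ Real.exp 8 * (2 * (2 * L)) := by gcongr
      have h2 : 4 * L * (Real.exp 8 * (2 * (2 * L))) ≤ 4 * L * g := by
        refine le_trans ?_ hgL
        have : 0 ≤ Real.exp 8 * L ^ 2 := by positivity
        linarith
      have h3 := le_of_mul_le_mul_left h2 (by linarith)
      linarith
    have hc2 : Real.exp (s * Real.exp 8 * ℓ / g) - 1 ≤ 2 * (s * Real.exp 8 * ℓ / g) := by
      have := Real.abs_exp_sub_one_le (x := s * Real.exp 8 * ℓ / g) (by rwa [abs_of_nonneg hc0])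
      rw [abs_of_nonneg hc0] at this
      exact (le_abs_self _).trans this
    calc s * (Real.exp (s * Real.exp 8 * ℓ / g) - 1) / g
        ≤ s * (2 * (s * Real.exp 8 * ℓ / g)) / g := by gcongr
      _ = 2 * Real.exp 8 * (s * (s * ℓ)) / g ^ 2 := by field_simp
      _ ≤ 2 * Real.exp 8 * (2 * L / q * (2 * (2 * L))) / (q * n / (4 * L)) ^ 2 := by
          have h1 : (s : ℝ) ≤ 2 * L / q := by rwa [le_div_iff₀ hq0]
          have h2 : q * n / (4 * L) ≤ g := by
            rw [div_le_iff₀ (by positivity)]; linarith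
          gcongr
      _ = 256 * Real.exp 8 * L ^ 4 / (q ^ 3 * n ^ 2) := by
          field_simp
          ring
  · have h2 : (2 : ℝ) ^ s ≤ Real.exp s := by
      have : (2 : ℝ) ≤ Real.exp 1 := by linarith [Real.add_one_le_exp (1 : ℝ)]
      calc (2 : ℝ) ^ s ≤ Real.exp 1 ^ s := pow_le_pow_left₀ (by norm_num) this s
        _ = Real.exp s := by rw [← Real.exp_nat_mul]; simp
    calc Real.exp (-(2 * s)) * 2 ^ s ≤ Real.exp (-(2 * s)) * Real.exp s := by gcongr
      _ = Real.exp (-s) := by rw [← Real.exp_add]; ring_nf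

/-- Existence of large empty squares with high probability. -/
theorem exists_forall_bernProb_maxEmptySquare (ε η : ℝ) (hε0 : 0 < ε) (hε1 : ε < 1) (hη : 0 < η)
    (hη1 : η ≤ 1) :
    ∃ K : ℝ, 100 / ε ≤ K ∧ 20 / η ≤ K ∧ ∀ (n : ℕ) (q : ℝ), 0 < q → K * q ≤ 1 →
      K ≤ Real.log (q * n) →
      Real.log (q * n) ^ 2 ≤ q * n / 4096 ∧
      1 - 0.6 * η ≤ bernProb q fun ω : Fin n × Fin n → Bool =>
        (2 - 0.75 * ε) * Real.log (q * n) / q - 1 ≤ maxEmptySquare ω := by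
  obtain ⟨C, hC⟩ : ∃ C : ℝ, C = 256 * Real.exp 8 := ⟨_, rfl⟩
  have hC256 : 256 ≤ C := by
    have := Real.one_le_exp (show (0 : ℝ) ≤ 8 by norm_num)
    linarith
  have hC0 : 0 < C := by linarith
  -- A concentration exponent of at least `V₀` makes the error at most `η / 4`, and `V₀ ≥ 2` leaves
  -- room for the factor 2 in the lower bound on `Pr`. The last term of the threshold `K` below
  -- forces the exponent above `V₀` when the second moment is not good enough.
  obtain ⟨V₀, hV₀⟩ : ∃ V : ℝ, V = 2 + -Real.log (η / 4) := ⟨_, rfl⟩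
  have hlogη : Real.log (η / 4) < 0 := Real.log_neg (by positivity) (by linarith)
  have hV₀2 : 2 ≤ V₀ := by linarith
  obtain ⟨K, hK0, hK⟩ := exists_forall_log_growth (ε / 8) (by positivity)
    (min (1 / (16 * C)) (ε ^ 2 / (2048 * C))) (by positivity)
    (max (max (100 / ε) (20 / η)) (4 * C * (1024 / ε ^ 2) ^ 2 * V₀ ^ 2 / η))
  have hK1 : 100 / ε ≤ K := (le_max_left _ _).trans ((le_max_left _ _).trans hK0)
  have hK2 : 20 / η ≤ K := (le_max_right _ _).trans ((le_max_left _ _).trans hK0)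
  have hK3 : 4 * C * (1024 / ε ^ 2) ^ 2 * V₀ ^ 2 / η ≤ K := (le_max_right _ _).trans hK0
  have hK100 : 100 ≤ K := by
    refine le_trans ?_ hK1
    rw [le_div_iff₀ hε0]; linarith
  refine ⟨K, hK1, hK2, ?_⟩
  intro n q hq0 hKq hKL
  obtain ⟨L, hL⟩ : ∃ L, L = Real.log (q * n) := ⟨_, rfl⟩
  rw [← hL] at hKL ⊢
  have hqn0 : 0 < q * n := by
    by_contra h
    push Not at h
    have : q * (n : ℝ) = 0 := le_antisymm h (by positivity)
    rw [this, Real.log_zero] at hL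
    linarith
  have hn0 : (0 : ℝ) < n := pos_of_mul_pos_right hqn0 hq0.le
  have hqnL : q * n = Real.exp L := by rw [hL, Real.exp_log hqn0]
  obtain ⟨hlog4, hL2⟩ := hK L hKL
  have hL100 : 100 ≤ L := hK100.trans hKL
  have hL0 : 0 < L := by linarith
  have hεL : 100 ≤ ε * L := by
    have := hK1.trans hKL
    rw [div_le_iff₀ hε0] at this
    linarith
  have hqε : 100 * q ≤ ε := by
    have h1 : 100 / ε * q ≤ 1 := (mul_le_mul_of_nonneg_right hK1 hq0.le).trans hKq
    rw [div_mul_eq_mul_div, div_le_one hε0] at h1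
    exact h1
  have hq1 : q ≤ 1 := by linarith
  have hL216 : 16 * C * L ^ 2 ≤ q * n := by
    have := hL2.trans (mul_le_mul_of_nonneg_right (min_le_left _ _) (Real.exp_pos L).le)
    rw [← hqnL, div_mul_eq_mul_div, one_mul, le_div_iff₀ (by positivity)] at this
    linarith
  have hL2ε : 2048 * C * L ^ 2 ≤ ε ^ 2 * (q * n) := by
    have := hL2.trans (mul_le_mul_of_nonneg_right (min_le_right _ _) (Real.exp_pos L).le)
    rw [← hqnL, div_mul_eq_mul_div, le_div_iff₀ (by positivity)] at this
    linarith
  have hCL : 256 * L ^ 2 ≤ C * L ^ 2 := by gcongr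
  refine ⟨by linarith, ?_⟩
  obtain ⟨s, hslow, hsL, hsup, hPr⟩ := exists_square_second_moment hε0 hε1 hq0 hqn0 hL hlog4
    hL100 hεL hqε (by rw [hC] at hL216; linarith)
  rw [← hC] at hPr
  obtain ⟨W, hW⟩ : ∃ W, W = C * L ^ 4 / (q ^ 3 * n ^ 2) := ⟨_, rfl⟩
  rw [← hW] at hPr
  have hexps : Real.exp (-(s : ℝ)) ≤ η / 20 := by
    have h1 := Real.add_one_le_exp (s : ℝ)
    have h2 : 20 / η ≤ Real.exp s := by linarith
    rw [Real.exp_neg, inv_le_comm₀ (Real.exp_pos _) (by positivity), inv_div]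
    exact h2
  have hlevel : (2 - 0.75 * ε) * L / q - 1 ≤ s - 2 * (ε * L / (16 * q)) := by
    have : (2 - 0.75 * ε) * L / q = (2 - 0.625 * ε) * L / q - 2 * (ε * L / (16 * q)) := by
      field_simp
      ring
    linarith
  obtain ⟨Pr, hPrdef⟩ : ∃ p, p = bernProb q (fun ω : Fin n × Fin n → Bool =>
    (s : ℝ) ≤ maxEmptySquare ω) := ⟨_, rfl⟩
  have hPreq : bernProb q (fun ω : Fin n × Fin n → Bool => HasEmptySquare ω s) = Pr := by
    rw [hPrdef]
    congr 1
    ext ω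
    rw [hasEmptySquare_iff, Nat.cast_le]
  rw [hPreq] at hPr
  have hPr0 : 0 ≤ Pr := by rw [hPrdef]; exact bernProb_nonneg hq0.le hq1 _
  have hτ0 : 0 ≤ ε * L / (16 * q) := by positivity
  -- For small `W` the second moment alone gives probability near one. For larger `W` it gives only
  -- about `exp (-W)`, which is boosted with `τ = ε L / (16 q)`: the concentration exponent `ε ^ 2 *
  -- A / 1024` is at least `2 * W`, because `W = C q A ^ 2` and `q A = L ^ 2 / (q n)` is small. The
  -- loss `2 * τ` moves the side from `0.625 ε` to `0.75 ε`.
  rcases le_or_gt W (η / 4) with hcase | hcase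
  · have h1 : Real.exp W ≤ 1 + η / 2 := by
      have hW0 : 0 ≤ W := by rw [hW]; positivity
      have := Real.abs_exp_sub_one_le (x := W) (by rw [abs_of_nonneg hW0]; linarith)
      rw [abs_of_nonneg hW0] at this
      have := (le_abs_self _).trans this
      linarith
    have h2 : 1 ≤ Pr * (1 + 0.6 * η) := hPr.trans (mul_le_mul_of_nonneg_left (by linarith) hPr0)
    have h3 : 1 - 0.6 * η ≤ Pr := by
      by_contra hlt
      push Not at hlt
      have h4 : Pr * (1 + 0.6 * η) ≤ (1 - 0.6 * η) * (1 + 0.6 * η) := by gcongr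
      have : 0 < η * η := by positivity
      linarith
    refine h3.trans ?_
    rw [hPrdef]
    exact bernProb_mono hq0.le hq1 fun ω hω => hlevel.trans (by linarith)
  · obtain ⟨A, hA⟩ : ∃ A, A = L ^ 2 / (q ^ 2 * n) := ⟨_, rfl⟩
    have hA0 : 0 < A := by rw [hA]; positivity
    have hV : (ε * L / (16 * q)) ^ 2 / (4 * n) = ε ^ 2 / 1024 * A := by
      rw [hA]; field_simp; ring
    have hqA : 2048 * C * (q * A) ≤ ε ^ 2 := by
      have : q * A = L ^ 2 / (q * n) := by rw [hA]; field_simp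
      rw [this, mul_div_assoc', div_le_iff₀ hqn0]
      exact hL2ε
    have hWA : W = C * (q * A) * A := by
      rw [hW, hA]; field_simp
    have hVW : 2 * W ≤ ε ^ 2 / 1024 * A := by
      rw [hWA]
      have : 2048 * C * (q * A) * A ≤ ε ^ 2 * A := by gcongr
      linarith
    have hVV : V₀ ≤ ε ^ 2 / 1024 * A := by
      have h1 : η / 4 < C * q * A ^ 2 := by rw [hWA] at hcase; linarith
      have h2 : 4 * C * (1024 / ε ^ 2) ^ 2 * V₀ ^ 2 / η * q ≤ 1 :=
        (mul_le_mul_of_nonneg_right hK3 hq0.le).trans hKq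
      have h3 : (1024 / ε ^ 2) ^ 2 * V₀ ^ 2 * (C * q) ≤ A ^ 2 * (C * q) := by
        rw [div_mul_eq_mul_div, div_le_one hη] at h2
        linarith
      have h4 := le_of_mul_le_mul_right h3 (by positivity)
      rw [← mul_pow] at h4
      have h5 := (pow_le_pow_iff_left₀ (by positivity) hA0.le two_ne_zero).1 h4
      rw [div_mul_eq_mul_div, div_le_iff₀ (by positivity)] at h5
      linarith
    have hsmall : Real.exp (-(ε ^ 2 / 1024 * A)) ≤ η / 4 := by
      rw [← Real.le_log_iff_exp_le (by positivity)]
      linarith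
    have hgt : Real.exp (-(ε ^ 2 / 1024 * A)) < Pr := by
      by_contra hle
      push Not at hle
      have h1 : Real.exp W + Real.exp (-s) ≤ 2 * Real.exp W := by
        have : Real.exp (-(s : ℝ)) ≤ Real.exp W := by
          refine Real.exp_le_exp.2 ?_
          linarith
        linarith
      have h2 : Pr * (Real.exp W + Real.exp (-s)) ≤
          Real.exp (-(ε ^ 2 / 1024 * A)) * (2 * Real.exp W) := by gcongr
      have h3 : Real.exp (-(ε ^ 2 / 1024 * A)) * (2 * Real.exp W) =
          2 * Real.exp (W - ε ^ 2 / 1024 * A) := by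
        rw [mul_left_comm, ← Real.exp_add]; ring_nf
      have h4 : Real.exp (W - ε ^ 2 / 1024 * A) ≤ Real.exp (-1) := Real.exp_le_exp.2 (by linarith)
      have h5 : Real.exp (-1) < 1 / 2 := by
        have := Real.exp_neg_one_lt_d9
        linarith
      linarith
    have hboost := bernProb_boost (n := n) (a := s) (τ := ε * L / (16 * q))
      (by exact_mod_cast hn0) hq0.le hq1 hτ0 (by
        rw [div_le_iff₀ (by positivity)]
        have h1 : ε * L ≤ 1 * L := by gcongr
        have h2 : 100 * L ≤ L ^ 2 := by rw [sq]; gcongr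
        linarith) (fun ω => (maxEmptySquare ω : ℝ)) (by
          intro ω ω' i h
          exact_mod_cast maxEmptySquare_le_add_one ω ω' i h) (by rw [hV, ← hPrdef]; exact hgt)
    rw [hV] at hboost
    refine le_trans (by linarith) (hboost.trans (bernProb_mono hq0.le hq1 ?_))
    intro ω hω
    exact hlevel.trans hω

/-- The sparse regime: the dimension is below `n - (2 - ε) log (q n) / q`. -/
theorem exists_forall_bernProb_posetDim_lt_sparse (ε η : ℝ) (hε0 : 0 < ε) (hε1 : ε < 1)
    (hη : 0 < η) (hη1 : η ≤ 1) :
    ∃ K : ℝ, ∀ (n : ℕ) (q : ℝ), 0 < q → K * q ≤ 1 → K ≤ Real.log (q * n) →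
      1 - η ≤ bernProb q fun ω : Fin n × Fin n → Bool =>
        (posetDim (bipartitePoset {e | ω e = false}) : ℝ) <
          n - (2 - ε) * Real.log (q * n) / q := by
  obtain ⟨K, hK1, hK2, hK⟩ := exists_forall_bernProb_maxEmptySquare ε η hε0 hε1 hη hη1
  refine ⟨K, fun n q hq0 hKq hKL => ?_⟩
  obtain ⟨hL2, hprob⟩ := hK n q hq0 hKq hKL
  obtain ⟨L, hL⟩ : ∃ L, L = Real.log (q * n) := ⟨_, rfl⟩
  rw [← hL] at hKL hL2 hprob ⊢
  have hεL : 100 ≤ ε * L := by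
    have := hK1.trans hKL
    rw [div_le_iff₀ hε0] at this
    linarith
  have hL0 : 0 < L := by
    by_contra h
    push Not at h
    have : ε * L ≤ 0 := mul_nonpos_of_nonneg_of_nonpos hε0.le h
    linarith
  have hL100 : 100 ≤ L := by
    have : ε * L ≤ 1 * L := by gcongr
    linarith
  have hqε : 100 * q ≤ ε := by
    have h1 : 100 / ε * q ≤ 1 := (mul_le_mul_of_nonneg_right hK1 hq0.le).trans hKq
    rw [div_mul_eq_mul_div, div_le_one hε0] at h1
    exact h1
  have hq1 : q ≤ 1 := by linarith
  obtain ⟨hl1, -, -⟩ := neg_log_one_sub_bounds hq0 (by linarith)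
  have hLL : 100 * L ≤ L ^ 2 := by rw [sq]; gcongr
  have hqnn : q * n ≤ 1 * n := by gcongr
  have hnL : 100 * L ≤ n := by linarith
  -- `r q m ≥ 2 n` beats `4 ^ n ≤ exp (1.4 n)`, while `r`, of order `1 / q`, is absorbed by the
  -- remaining slack `0.25 ε L / q ≥ 25 / q`.
  obtain ⟨r, hr1, hr2⟩ : ∃ r : ℕ, 8 / q ≤ r ∧ (r : ℝ) < 8 / q + 1 :=
    ⟨⌈8 / q⌉₊, Nat.le_ceil _, Nat.ceil_lt_add_one (by positivity)⟩
  obtain ⟨m, hm1, hm2⟩ : ∃ m : ℕ, (n : ℝ) / 4 ≤ m ∧ (m : ℝ) < n / 4 + 1 :=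
    ⟨⌈(n : ℝ) / 4⌉₊, Nat.le_ceil _, Nat.ceil_lt_add_one (by positivity)⟩
  have hx0 : 0 ≤ (2 - 0.75 * ε) * L / q := by
    have : 0 ≤ 2 - 0.75 * ε := by linarith
    positivity
  obtain ⟨k, hk1, hk2⟩ : ∃ k : ℕ, (2 - 0.75 * ε) * L / q - 2 < k ∧
      (k : ℝ) ≤ (2 - 0.75 * ε) * L / q - 1 := by
    have h1 : 1 ≤ (2 - 0.75 * ε) * L / q := by
      rw [le_div_iff₀ hq0]
      have : ε * L ≤ 1 * L := by gcongr
      linarith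
    refine ⟨⌊(2 - 0.75 * ε) * L / q - 1⌋₊, ?_, Nat.floor_le (by linarith)⟩
    linarith [Nat.lt_floor_add_one ((2 - 0.75 * ε) * L / q - 1)]
  have hr0 : 0 < r := by
    have : (0 : ℝ) < r := lt_of_lt_of_le (by positivity) hr1
    exact_mod_cast this
  have hkm : k + 2 * m ≤ n := by
    have h1 : (2 - 0.75 * ε) * L / q ≤ n / 10 := by
      rw [div_le_iff₀ hq0]
      have : 0 ≤ ε * L := by linarith
      linarith
    have : (k : ℝ) + 2 * m ≤ n := by linarith
    exact_mod_cast this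
  have hU := bernProb_noEmptyRectangle (n := n) hq0.le hq1 r m
  have hUs : 2 * 4 ^ n * (1 - q) ^ (r * m) ≤ 0.4 * η := by
    have h1 : (1 - q) ^ (r * m) = Real.exp (-(-Real.log (1 - q) * (r * m))) := by
      rw [neg_mul, neg_neg, mul_comm (Real.log (1 - q)), ← Nat.cast_mul, Real.exp_nat_mul,
        Real.exp_log (by linarith)]
    have h2 : 8 * ((n : ℝ) / 4) ≤ r * q * m := by
      rw [div_le_iff₀ hq0] at hr1
      gcongr
    have h3 : q * (r * m : ℝ) ≤ -Real.log (1 - q) * (r * m) := by gcongr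
    have h4 : (4 : ℝ) ^ n * (1 - q) ^ (r * m) ≤ Real.exp (-L) := by
      rw [h1]
      refine (mul_le_mul_of_nonneg_right (four_pow_le_exp n) (Real.exp_pos _).le).trans ?_
      rw [← Real.exp_add, Real.exp_le_exp]
      linarith
    have h5 : Real.exp (-L) ≤ η / 20 := by
      have h1 := Real.add_one_le_exp L
      have h2 : 20 / η ≤ Real.exp L := by linarith
      rw [Real.exp_neg, inv_le_comm₀ (Real.exp_pos _) (by positivity), inv_div]
      exact h2
    rw [mul_assoc]
    linarith
  have hboth := (bernProb_or_le hq0.le hq1 _ _).trans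
    (add_le_add (bernProb_not_le hprob) (bernProb_not_le hU))
  refine le_trans (b := 1 - (0.6 * η + 2 * 4 ^ n * (1 - q) ^ (r * m))) (by linarith)
    (one_sub_le_bernProb ((bernProb_mono hq0.le hq1 ?_).trans hboth))
  intro ω hω
  by_contra hnot
  push Not at hnot
  refine hω ?_
  obtain ⟨h1, h2⟩ := hnot
  have hsq : HasEmptySquare ω k := by
    rw [hasEmptySquare_iff]
    have : (k : ℝ) ≤ maxEmptySquare ω := hk2.trans h1
    exact_mod_cast this
  have hdim := posetDim_add_le_of_hasEmptySquare hsq h2 hr0 hkm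
  have hdim' : (posetDim (bipartitePoset {e | ω e = false}) : ℝ) + k ≤ n + r + 2 := by
    exact_mod_cast hdim
  have hgap : 8 / q + 5 < (2 - 0.75 * ε) * L / q - (2 - ε) * L / q := by
    rw [← sub_div, lt_div_iff₀ hq0, add_mul, div_mul_cancel₀ _ hq0.ne']
    linarith
  linarith

/-! ### Estimates for the Euler product -/

theorem eulerProduct_bounds {q : ℝ} (h0 : 0 < q) (h1 : q ≤ 1 / 2) :
    1 - q - q ^ 2 + q ^ 5 ≤ eulerProduct q ∧ eulerProduct q ≤ 1 - q := by
  have hlim := (multipliable_eulerProduct (q := q) (by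
    rw [abs_of_pos h0]; linarith)).hasProd.tendsto_prod_nat
  -- The lower bound factors as `(1 - q ^ 2) (1 - q - q ^ 3)`; the extra `q ^ (n + 3)` gives
  -- equality at `n = 0` and survives multiplication by the next factor.
  have hlow : ∀ n : ℕ, (1 - q ^ 2) * (1 - q - q ^ 3 + q ^ (n + 3)) ≤
      ∏ i ∈ Finset.range (n + 2), (1 - q ^ (i + 1)) := by
    intro n
    induction n with
    | zero =>
      rw [Finset.prod_range_succ, Finset.prod_range_one]
      exact le_of_eq (by ring)
    | succ n ih =>
      rw [Finset.prod_range_succ]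
      have hp : q ^ (n + 2 + 1) ≤ 1 := pow_le_one₀ h0.le (by linarith)
      refine le_trans ?_ (mul_le_mul_of_nonneg_right ih (by linarith))
      rw [mul_assoc]
      refine mul_le_mul_of_nonneg_left ?_ (by nlinarith)
      have hx : q ^ n * q ^ n ≤ q ^ n * 1 :=
        mul_le_mul_of_nonneg_left (pow_le_one₀ h0.le (by linarith)) (by positivity)
      have h6 : q ^ 6 * (q ^ n * q ^ n) ≤ q ^ 6 * (q ^ n * 1) :=
        mul_le_mul_of_nonneg_left hx (by positivity)
      have e1 : (1 - q - q ^ 3 + q ^ (n + 3)) * (1 - q ^ (n + 2 + 1)) =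
          1 - q - q ^ 3 + q ^ (n + 1 + 3) + (q ^ 6 * (q ^ n * 1) - q ^ 6 * (q ^ n * q ^ n)) := by
        ring
      linarith
  have hup : ∀ n : ℕ, 0 ≤ ∏ i ∈ Finset.range (n + 1), (1 - q ^ (i + 1)) ∧
      ∏ i ∈ Finset.range (n + 1), (1 - q ^ (i + 1)) ≤ 1 - q := by
    intro n
    induction n with
    | zero => simp; linarith
    | succ n ih =>
      rw [Finset.prod_range_succ]
      have hp : q ^ (n + 1 + 1) ≤ 1 := pow_le_one₀ h0.le (by linarith)
      have hp0 : 0 ≤ q ^ (n + 1 + 1) := by positivity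
      exact ⟨mul_nonneg ih.1 (by linarith),
        (mul_le_of_le_one_right ih.1 (by linarith)).trans ih.2⟩
  constructor
  · refine ge_of_tendsto hlim (Filter.eventually_atTop.2 ⟨2, fun n hn => ?_⟩)
    obtain ⟨k, rfl⟩ := Nat.exists_eq_add_of_le' hn
    refine le_trans ?_ (hlow k)
    have : 0 ≤ (1 - q ^ 2) * q ^ (k + 3) := mul_nonneg (by nlinarith) (by positivity)
    linarith
  · refine le_of_tendsto hlim (Filter.eventually_atTop.2 ⟨1, fun n hn => ?_⟩)
    obtain ⟨k, rfl⟩ := Nat.exists_eq_add_of_le' hn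
    exact (hup k).2

/-- The constant must stay below `2 / 1.05`, so that the criterion with `2.1 * log S` applies. It
arises from `φ(q) ≥ (1 - q) ^ 2 (1 + 0.2 q)` and `(1 + 0.2 q) ^ 10 ≥ (1 - q)⁻¹`, which give `2 - 1 /
10`. -/
theorem log_inv_eulerProduct_bounds {q : ℝ} (h0 : 0 < q) (h1 : q ≤ 1 / 2) :
    q ≤ Real.log (1 / eulerProduct q) ∧
      Real.log (1 / eulerProduct q) ≤ 1.9 * -Real.log (1 - q) := by
  obtain ⟨hlow, hup⟩ := eulerProduct_bounds h0 h1
  have hpoly : (1 - q) ^ 2 * (1 + 0.2 * q) ≤ 1 - q - q ^ 2 + q ^ 5 := by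
    have : 0 ≤ 0.8 - 1.6 * q - 0.2 * q ^ 2 + q ^ 4 := by
      nlinarith [sq_nonneg (q ^ 2 - 1 / 4), sq_nonneg (q - 1 / 2)]
    have := mul_nonneg h0.le this
    linarith
  have hq : 0 < 1 - q := by linarith
  have hpos : 0 < (1 - q) ^ 2 * (1 + 0.2 * q) := by positivity
  have hφ : 0 < eulerProduct q := by linarith
  rw [one_div, Real.log_inv]
  constructor
  · have := Real.log_le_log hφ hup
    linarith [(neg_log_one_sub_bounds h0 h1).1]
  · have h2 := Real.log_le_log hpos (hpoly.trans hlow)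
    rw [Real.log_mul (by positivity) (by positivity), Real.log_pow] at h2
    have h3 : 1 ≤ (1 + 0.2 * q) ^ 10 * (1 - q) := by
      have := one_add_mul_le_pow (show (-2 : ℝ) ≤ 0.2 * q by linarith) 10
      have h4 : (1 + 2 * q) * (1 - q) ≤ (1 + 0.2 * q) ^ 10 * (1 - q) := by
        refine mul_le_mul_of_nonneg_right ?_ hq.le
        refine le_trans (le_of_eq ?_) this
        push_cast; ring
      nlinarith
    have h5 := Real.log_le_log one_pos h3
    rw [Real.log_one, Real.log_mul (by positivity) hq.ne', Real.log_pow] at h5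
    push_cast at h2 h5
    linarith

/-! ### The three ranges of `q` and the limit -/

/-- Uniformity in `q` lets the limit be taken along an arbitrary sequence. Up to `n^(-1/2) log n`
the empty square is used; above it `q ^ 2 n ≥ log² n`, which makes `q S` at least `(log n) / 2` for
both values of the saving `S`, and the block construction applies. -/
theorem eventually_bernProb_posetDim_lt (ε η : ℝ) (hε0 : 0 < ε) (hε1 : ε < 1) (hη : 0 < η)
    (hη1 : η ≤ 1) :
    ∀ᶠ n : ℕ in Filter.atTop, ∀ q : ℝ, (n : ℝ)⁻¹ * Real.log n ^ 2 ≤ q → q ≤ 1 / 2 →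
      1 - η ≤ bernProb q fun ω : Fin n × Fin n → Bool =>
        (posetDim (bipartitePoset {e | ω e = false}) : ℝ) < dimUpperBound ε n q := by
  obtain ⟨K, hK⟩ := exists_forall_bernProb_posetDim_lt η hη
  obtain ⟨K', hK'⟩ := exists_forall_bernProb_posetDim_lt_sparse ε η hε0 hε1 hη hη1
  have hlogtop : Filter.Tendsto (fun n : ℕ => Real.log (n : ℝ)) Filter.atTop Filter.atTop :=
    Real.tendsto_log_atTop.comp tendsto_natCast_atTop_atTop
  have hsmall : Filter.Tendsto (fun n : ℕ => K' * ((n : ℝ) ^ (-(1 / 2) : ℝ) * Real.log n))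
      Filter.atTop (nhds 0) := by
    have h := (isLittleO_log_rpow_atTop (show (0 : ℝ) < 1 / 2 by norm_num)).tendsto_div_nhds_zero
    have h2 := (h.comp tendsto_natCast_atTop_atTop).const_mul K'
    rw [mul_zero] at h2
    refine h2.congr fun n => ?_
    simp only [Function.comp_apply]
    rw [Real.rpow_neg (Nat.cast_nonneg n), div_eq_mul_inv, mul_comm (Real.log _)]
  filter_upwards [hlogtop.eventually_ge_atTop 2, hlogtop.eventually_ge_atTop (2 * K),
    hlogtop.eventually_ge_atTop (Real.exp K'), hsmall.eventually_le_const one_pos,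
    Filter.eventually_gt_atTop 0] with n hl2 hlK hlK' hsm hn q hq1 hq2
  have hn0 : (0 : ℝ) < n := by exact_mod_cast hn
  obtain ⟨l, hl⟩ : ∃ l, l = Real.log n := ⟨_, rfl⟩
  have hqn : l ^ 2 ≤ q * n := by
    rw [inv_mul_le_iff₀ hn0, ← hl] at hq1
    linarith
  rw [← hl] at hl2 hlK hlK' hsm
  have hll : 2 * l ≤ l ^ 2 := by rw [sq]; gcongr
  have hqn4 : 4 ≤ q * n := by linarith
  have hq0 : 0 < q := pos_of_mul_pos_left (by linarith) hn0.le
  have hL1 : 1 ≤ Real.log (q * n) := by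
    rw [Real.le_log_iff_exp_le (by linarith)]
    linarith [Real.exp_one_lt_d9]
  have hLl : Real.log (q * n) ≤ l := by
    rw [hl]
    refine Real.log_le_log (by linarith) ?_
    have : q * n ≤ 1 * n := by gcongr; linarith
    linarith
  have hrpow : ((n : ℝ) ^ (-(1 / 2) : ℝ)) ^ 2 * n = 1 := by
    rw [← Real.rpow_natCast, ← Real.rpow_mul hn0.le]
    norm_num [Real.rpow_neg_one, inv_mul_cancel₀ hn0.ne']
  obtain ⟨hl1, hlq, hl7⟩ := neg_log_one_sub_bounds hq0 hq2
  rw [dimUpperBound, ← hl]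
  split_ifs with hc1 hc2
  · refine hK' n q hq0 ?_ ?_
    · rcases le_or_gt 0 K' with h | h
      · exact (mul_le_mul_of_nonneg_left hc1 h).trans hsm
      · linarith [mul_neg_of_neg_of_pos h hq0]
    · rw [Real.le_log_iff_exp_le (by linarith)]
      linarith
  all_goals
    have hq2n : l ^ 2 ≤ q ^ 2 * n := by
      push Not at hc1
      have h1 : ((n : ℝ) ^ (-(1 / 2) : ℝ) * l) ^ 2 * n ≤ q ^ 2 * n := by gcongr
      rw [mul_pow, mul_right_comm, hrpow, one_mul] at h1
      exact h1
  · refine hK n q _ hq0 hq2 ?_ (by positivity) ?_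
    · rw [← mul_div_assoc, le_div_iff₀ (by linarith)]
      have h1 : K * (2 * Real.log (q * n)) ≤ l / 2 * (2 * l) := by
        have : K ≤ l / 2 := by linarith
        gcongr
      linarith
    · have h1 : (n : ℝ) / (q * n / (2 * Real.log (q * n))) = 2 * Real.log (q * n) / q := by
        field_simp
      rw [h1]
      have h2 : Real.log (q * n / (2 * Real.log (q * n))) ≤ Real.log (q * n) := by
        exact Real.log_le_log (by positivity) (div_le_self (by linarith) (by linarith))
      have h3 : 2 * q * (2 * Real.log (q * n) / q) ≤
          2 * -Real.log (1 - q) * (2 * Real.log (q * n) / q) := by gcongr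
      have h4 : 2 * q * (2 * Real.log (q * n) / q) = 4 * Real.log (q * n) := by
        field_simp; ring
      linarith
  · obtain ⟨hlam1, hlam2⟩ := log_inv_eulerProduct_bounds hq0 hq2
    generalize Real.log (1 / eulerProduct q) = lam at hlam1 hlam2 ⊢
    have hlam0 : 0 < lam := by linarith
    have hz1 : 2 * l ≤ q ^ 2 * n * n := by
      have hn1 : (1 : ℝ) ≤ n := by exact_mod_cast hn
      have : l ^ 2 * 1 ≤ q ^ 2 * n * n := by gcongr
      linarith
    have hz0 : 0 < (n : ℝ) ^ 2 * q * lam := by positivity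
    have hzlow : q ^ 2 * n * n ≤ (n : ℝ) ^ 2 * q * lam := by
      have : (n : ℝ) ^ 2 * q * q ≤ (n : ℝ) ^ 2 * q * lam := by gcongr
      linarith
    have hz2 : 2 ≤ Real.log ((n : ℝ) ^ 2 * q * lam) := by
      have h16 : (4 : ℝ) * 4 ≤ (q * n) * (q * n) := by gcongr
      have h9 : Real.exp 2 ≤ 16 := by
        have h1 := Real.exp_one_lt_d9
        have h2 : Real.exp 2 = Real.exp 1 * Real.exp 1 := by rw [← Real.exp_add]; norm_num
        have h3 : Real.exp 1 * Real.exp 1 ≤ 4 * 4 := by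
          gcongr <;> linarith
        linarith
      rw [Real.le_log_iff_exp_le hz0]
      linarith
    have hz3 : Real.log ((n : ℝ) ^ 2 * q * lam) ≤ 2 * l := by
      rw [hl, show (2 : ℝ) * Real.log n = Real.log ((n : ℝ) ^ 2) by rw [Real.log_pow]; norm_num]
      refine Real.log_le_log hz0 ?_
      have : (n : ℝ) ^ 2 * (q * lam) ≤ (n : ℝ) ^ 2 * (1 / 2 * 2) := by
        gcongr
        linarith
      linarith
    generalize hZ : Real.log ((n : ℝ) ^ 2 * q * lam) = Z at hz2 hz3 ⊢
    have hZ0 : 0 < Z := by linarith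
    refine hK n q _ hq0 hq2 ?_ (by positivity) ?_
    · rw [← mul_div_assoc, le_div_iff₀ hZ0]
      have h1 : K * Z ≤ l / 2 * (2 * l) := by
        have : K ≤ l / 2 := by linarith
        gcongr
      have h2 : q * (n * q) ≤ q * (n * lam) := by gcongr
      linarith
    · have h1 : (n : ℝ) / (n * lam / Z) = Z / lam := by field_simp
      rw [h1]
      -- With `S = n lam / Z` this says `S ^ 2 ≤ n ^ 2 q lam`, that is `lam ≤ q Z ^ 2`; it holds
      -- since `lam ≤ 3.8 q` and `Z ≥ 2`.
      have h2 : 2 * Real.log (n * lam / Z) ≤ Z := by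
        rw [show 2 * Real.log (n * lam / Z) = Real.log ((n * lam / Z) ^ 2) by
          rw [Real.log_pow]; norm_num]
        refine (Real.log_le_log (pow_pos (div_pos (mul_pos hn0 hlam0) hZ0) 2) ?_).trans_eq hZ
        rw [div_pow, div_le_iff₀ (by positivity)]
        have h4 : lam ≤ q * Z ^ 2 := by
          have h5 : q * (2 ^ 2) ≤ q * Z ^ 2 := by gcongr
          linarith
        have h6 : (n : ℝ) ^ 2 * lam * lam ≤ (n : ℝ) ^ 2 * lam * (q * Z ^ 2) := by gcongr
        linarith
      have h3 : 1.05 * Z ≤ 2 * -Real.log (1 - q) * (Z / lam) := by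
        rw [← mul_div_assoc, le_div_iff₀ hlam0]
        have : Z * lam ≤ Z * (1.9 * -Real.log (1 - q)) := by gcongr
        have h0 : 0 ≤ Z * -Real.log (1 - q) := mul_nonneg hZ0.le (by linarith)
        linarith
      linarith

theorem mainTheorem2 (ε : ℝ) (hε0 : 0 < ε) (hε1 : ε < 1) (q : ℕ → unitInterval)
    (hq : ∀ᶠ n : ℕ in Filter.atTop,
      (n : ℝ)⁻¹ * Real.log n ^ 2 ≤ (q n : ℝ) ∧ (q n : ℝ) ≤ 1 / 2) :
    Filter.Tendsto
      (fun n : ℕ => randomBipartite n (unitInterval.symm (q n))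
        {R | (posetDim (bipartitePoset R) : ℝ) < dimUpperBound ε n (q n)})
      Filter.atTop (nhds 1) := by
  have h : Filter.Tendsto (fun n : ℕ => bernProb (q n : ℝ) fun ω : Fin n × Fin n → Bool =>
      (posetDim (bipartitePoset {e | ω e = false}) : ℝ) < dimUpperBound ε n (q n))
      Filter.atTop (nhds 1) := by
    rw [tendsto_order]
    refine ⟨fun a ha => ?_, fun a ha => Filter.Eventually.of_forall fun n =>
      (bernProb_le_one (q n).2.1 (q n).2.2 _).trans_lt ha⟩
    have hη : 0 < min 1 ((1 - a) / 2) := lt_min one_pos (by linarith)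
    filter_upwards [hq, eventually_bernProb_posetDim_lt ε _ hε0 hε1 hη (min_le_left _ _)]
      with n hqn hn
    have := min_le_right 1 ((1 - a) / 2)
    linarith [hn (q n) hqn.1 hqn.2]
  rw [← ENNReal.ofReal_one]
  refine (ENNReal.tendsto_ofReal h).congr fun n => ?_
  exact (randomBipartite_eq_bernProb n (q n) fun R =>
    (posetDim (bipartitePoset R) : ℝ) < dimUpperBound ε n (q n)).symm
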